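/- **Theorem 1.7.** Conventions. A knotoid diagram $K$ is an immersion of an oriented interval into the oriented sphere $S^2$ whose only multiple points are finitely many transverse double points (crossings), different from the two endpoints, with over/under information; its initial point $v_0$ is the tail and its final point $v_1$ the head. A knotoid $k$ is a class of knotoid diagrams up to planar isotopy and the Reidemeister moves I, II, III performed away from the endpoints. A shortcut for $K$ is an embedded path $a$ in $S^2$ from $v_0$ to $v_1$ that meets $K$, apart from the endpoints, in finitely many points, transversely and away from the crossings. An intersection point of $K$ and $a$ has sign $+$ if (direction of $a$, direction of $K$) is a positive basis of the tangent plane there, and sign $-$ otherwise. The sequence of these signs, in the order in which the intersections appear along $K$ from $v_0$ to $v_1$, is the sign sequence $\mathrm{Seq}(K,a)$. A finite (possibly empty) sequence of signs is *attainable* for $k$ if it is $\mathrm{Seq}(K,a)$ for some diagram $K$ representing $k$ and some shortcut $a$ for $K$. The index $\mathrm{Ind}(c)$ of a crossing $c$ of $K$ is the winding number, around the twice-punctured sphere $S^2\setminus\{v_0,v_1\}$ (counterclockwise around $v_0$ counted positively), of the loop formed by the part of $K$ between its two passages through $c$. For $n\neq 0$ let $J_n(K)$ be half the sum of the signs of the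 crossings of index $n$, a crossing being positive if (direction of the over-strand, direction of the under-strand) is a positive basis. The index polynomial of $k$ is $F_k(t)=\sum_{n\ne 0}J_n(K)(t^n-1)$, for any diagram $K$ representing $k$. For a nonzero Laurent polynomial $p$ put $\deg^+(p)=\max\{\mathrm{maxdeg}(p),0\}$ and $\deg^-(p)=\max\{-\mathrm{mindeg}(p),0\}$, and put $\deg^\pm(0)=0$. Statement. Let $k$ be a knotoid and let $A$ be an attainable sign sequence for $k$. Then, counting $+$ as $+1$ and $-$ as $-1$, the sequence $A$ has a (possibly empty) block of consecutive terms whose sum is $\deg^+(F_k)$, and a (possibly empty) block of consecutive terms whose sum is $-\deg^-(F_k)$. (This holds with $F_k$ computed from any diagram that represents $k$.) -/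

import Mathlib

open scoped ContDiff LaurentPolynomial

/-! ### The oriented sphere -/

/-- Euclidean three-space. -/
abbrev E3 : Type := EuclideanSpace ℝ (Fin 3)

/-- The sphere `S²`, as the unit sphere of three-space. It is oriented by its outward normal
and viewed from outside, so that a basis `(u, v)` of the tangent plane at `x` is positive
(counterclockwise) exactly when `triple x u v > 0`. -/
def S2 : Set E3 := Metric.sphere 0 1

/-- The determinant of three vectors of three-space. -/
def triple (x u v : E3) : ℝ := (Matrix.of fun i j : Fin 3 => ![x, u, v] i j).det

/-- `IsWindingNumber p q l s t n`: the closed curve `l : [s, t] → S² ∖ {p, q}` winds `n` times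
around the twice-punctured sphere `S² ∖ {p, q}`, counterclockwise around `p` being positive.
The sphere without `p` and `q` retracts to a circle that goes once around the straight line through
`p` and `q`; so the winding number is the total change, in full turns, of a continuous choice `θ`
of the angle of `l τ` around this line. The angle is measured in an orthonormal frame `(e₁, e₂)` of
the orthogonal complement of the line, positive with respect to the direction `p - q`. -/
def IsWindingNumber (p q : E3) (l : ℝ → E3) (s t : ℝ) (n : ℤ) : Prop :=
  ∃ e₁ e₂ : E3, ‖e₁‖ = 1 ∧ ‖e₂‖ = 1 ∧ inner ℝ e₁ e₂ = 0 ∧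
    inner ℝ (p - q) e₁ = 0 ∧ inner ℝ (p - q) e₂ = 0 ∧ 0 < triple (p - q) e₁ e₂ ∧
    ∃ θ : ℝ → ℝ, ContinuousOn θ (Set.Icc s t) ∧
      (∀ τ ∈ Set.Icc s t, ∃ r : ℝ, 0 < r ∧
        inner ℝ (l τ - p) e₁ = r * Real.cos (θ τ) ∧
        inner ℝ (l τ - p) e₂ = r * Real.sin (θ τ)) ∧
      θ t - θ s = 2 * Real.pi * n

/-! ### Knotoid diagrams -/

/-- A knotoid diagram: a smooth immersion `γ` of the interval `[0, 1]` into `S²`, all of whose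
multiple points are transverse double points different from the endpoints, with over/under
information. Only the restriction of `γ` to `[0, 1]` matters, and only the values of `passesOver` at pairs
of parameters of a double point matter. The tail is `γ 0`, the head is `γ 1`. -/
structure KnotoidDiagram where
  /-- the immersed curve -/
  γ : ℝ → E3
  smooth : ContDiff ℝ ∞ γ
  mem_sphere : ∀ t ∈ Set.Icc (0 : ℝ) 1, γ t ∈ S2
  immersed : ∀ t ∈ Set.Icc (0 : ℝ) 1, deriv γ t ≠ 0
  /-- there are finitely many double points -/
  finite_double :
    {c : ℝ × ℝ | c.1 ∈ Set.Icc 0 1 ∧ c.2 ∈ Set.Icc 0 1 ∧ c.1 < c.2 ∧ γ c.1 = γ c.2}.Finite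
  /-- the endpoints are not double points (and differ from each other) -/
  interior_double : ∀ s ∈ Set.Icc (0 : ℝ) 1, ∀ t ∈ Set.Icc (0 : ℝ) 1, s ≠ t → γ s = γ t →
    s ∈ Set.Ioo 0 1
  /-- there are no triple points -/
  no_triple : ∀ r ∈ Set.Icc (0 : ℝ) 1, ∀ s ∈ Set.Icc (0 : ℝ) 1, ∀ t ∈ Set.Icc (0 : ℝ) 1,
    γ r = γ s → γ s = γ t → r = s ∨ s = t ∨ r = t
  transverse : ∀ s ∈ Set.Icc (0 : ℝ) 1, ∀ t ∈ Set.Icc (0 : ℝ) 1, s ≠ t → γ s = γ t →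
    LinearIndependent ℝ ![deriv γ s, deriv γ t]
  /-- `passesOver s t`: at the double point `γ s = γ t`, the strand through time `s` passes over
  (on the outer side of) the strand through time `t` -/
  passesOver : ℝ → ℝ → Prop
  passesOver_iff : ∀ s ∈ Set.Icc (0 : ℝ) 1, ∀ t ∈ Set.Icc (0 : ℝ) 1, s ≠ t → γ s = γ t →
    (passesOver s t ↔ ¬ passesOver t s)

namespace KnotoidDiagram

/-- The curve passes through the same point at the two different times `s` and `t`. -/
def IsDouble (K : KnotoidDiagram) (s t : ℝ) : Prop :=
  s ∈ Set.Icc 0 1 ∧ t ∈ Set.Icc 0 1 ∧ s ≠ t ∧ K.γ s = K.γ t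

/-- The crossings; each is given by its two times, the earlier one first. -/
def crossings (K : KnotoidDiagram) : Set (ℝ × ℝ) :=
  {c | c.1 ∈ Set.Icc 0 1 ∧ c.2 ∈ Set.Icc 0 1 ∧ c.1 < c.2 ∧ K.γ c.1 = K.γ c.2}

open Classical in
/-- The sign of the crossing with times `s` and `t` (in either order): it is positive when the
direction of the over-strand followed by that of the under-strand is a positive basis. -/
noncomputable def crossingSign (K : KnotoidDiagram) (s t : ℝ) : ℤ :=
  if K.passesOver s t then (SignType.sign (triple (K.γ s) (deriv K.γ s) (deriv K.γ t)) : ℤ)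
  else (SignType.sign (triple (K.γ s) (deriv K.γ t) (deriv K.γ s)) : ℤ)

/-- The crossing `c` has intersection index `n`. The loop that the oriented resolution
of `c` splits off is the part of the curve between the two times of `c`; the index is its winding
number around the sphere punctured at the two endpoints of the diagram. -/
def HasIndex (K : KnotoidDiagram) (c : ℝ × ℝ) (n : ℤ) : Prop :=
  IsWindingNumber (K.γ 0) (K.γ 1) K.γ c.1 c.2 n

open Classical in
/-- The `n`-writhe: half the sum of the signs of the crossings of index `n`. -/
noncomputable def writhe (K : KnotoidDiagram) (n : ℤ) : ℚ :=
  (1 / 2) * ∑ c ∈ K.finite_double.toFinset with K.HasIndex c n, (K.crossingSign c.1 c.2 : ℚ)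

/-- The index polynomial `∑_{n ≠ 0} Jₙ (tⁿ - 1)`. Since the writhes are defined as half-sums of
integers, it is written with rational coefficients. -/
noncomputable def indexPolynomial (K : KnotoidDiagram) : ℚ[T;T⁻¹] :=
  ∑ᶠ (n : ℤ) (_ : n ≠ 0), LaurentPolynomial.C (K.writhe n) * (LaurentPolynomial.T n - 1)

end KnotoidDiagram

/-! ### Signed degrees of a Laurent polynomial -/

open Classical in
/-- `deg⁺ p = max (maxdeg p) 0`, and `deg⁺ 0 = 0`. -/
noncomputable def degPlus (p : ℚ[T;T⁻¹]) : ℤ :=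
  if h : p.coeff.support.Nonempty then max (p.coeff.support.max' h) 0 else 0

open Classical in
/-- `deg⁻ p = max (-mindeg p) 0`, and `deg⁻ 0 = 0`. -/
noncomputable def degMinus (p : ℚ[T;T⁻¹]) : ℤ :=
  if h : p.coeff.support.Nonempty then max (-(p.coeff.support.min' h)) 0 else 0

/-! ### Planar isotopy and the Reidemeister moves -/

/-- `Φ` is a smooth ambient isotopy of `S²` during the time `[0, 1]`, and `Ψ τ` is the inverse of
`Φ τ`. Both are given by smooth extensions to the ambient space; only their
values on `[0, 1] × S²` matter. -/
structure IsAmbientIsotopy (Φ Ψ : ℝ → E3 → E3) : Prop where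
  smooth : ContDiff ℝ ∞ (fun p : ℝ × E3 => Φ p.1 p.2)
  smooth_inv : ContDiff ℝ ∞ (fun p : ℝ × E3 => Ψ p.1 p.2)
  mapsTo : ∀ τ ∈ Set.Icc (0 : ℝ) 1, Set.MapsTo (Φ τ) S2 S2
  mapsTo_inv : ∀ τ ∈ Set.Icc (0 : ℝ) 1, Set.MapsTo (Ψ τ) S2 S2
  left_inv : ∀ τ ∈ Set.Icc (0 : ℝ) 1, ∀ x ∈ S2, Ψ τ (Φ τ x) = x
  right_inv : ∀ τ ∈ Set.Icc (0 : ℝ) 1, ∀ x ∈ S2, Φ τ (Ψ τ x) = x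
  start : ∀ x ∈ S2, Φ 0 x = x

namespace KnotoidDiagram

/-- `K'` is obtained from `K` by a planar isotopy. -/
def PlanarIsotopy (K K' : KnotoidDiagram) : Prop :=
  ∃ Φ Ψ : ℝ → E3 → E3, IsAmbientIsotopy Φ Ψ ∧
    (∀ t ∈ Set.Icc (0 : ℝ) 1, K'.γ t = Φ 1 (K.γ t)) ∧
    ∀ s t, K.IsDouble s t → (K'.passesOver s t ↔ K.passesOver s t)

/-- `K'` is obtained from `K` by an orientation-preserving change of parameter. (A knotoid diagram
is an oriented curve; its parametrization is immaterial.) -/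
def Reparametrization (K K' : KnotoidDiagram) : Prop :=
  ∃ ψ : ℝ → ℝ, ContDiff ℝ ∞ ψ ∧ (∀ t ∈ Set.Icc (0 : ℝ) 1, 0 < deriv ψ t) ∧ ψ 0 = 0 ∧ ψ 1 = 1 ∧
    (∀ t ∈ Set.Icc (0 : ℝ) 1, K'.γ t = K.γ (ψ t)) ∧
    ∀ s t, K'.IsDouble s t → (K'.passesOver s t ↔ K.passesOver (ψ s) (ψ t))

/-- `f` restricts to a smooth embedding of the closed unit disk of the plane into `S²`. -/
structure IsDiskEmbedding (f : EuclideanSpace ℝ (Fin 2) → E3) : Prop where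
  smooth : ContDiff ℝ ∞ f
  injOn : Set.InjOn f (Metric.closedBall 0 1)
  immersed : ∀ x ∈ Metric.closedBall (0 : EuclideanSpace ℝ (Fin 2)) 1,
    Function.Injective (fderiv ℝ f x)
  mapsTo : Set.MapsTo f (Metric.closedBall 0 1) S2

/-- The part of `K` in the disk with embedding `f` consists of the `m` arcs of `K` on the disjoint
time intervals `[l i, u i]`, with their endpoints on the boundary of the disk and everything
else in its interior; the endpoints of `K` are outside the disk. -/
structure MeetsDiskInArcs (K : KnotoidDiagram) (f : EuclideanSpace ℝ (Fin 2) → E3) {m : ℕ}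
    (l u : Fin m → ℝ) : Prop where
  interval : ∀ i, 0 < l i ∧ l i < u i ∧ u i < 1
  disjoint : ∀ i j, i ≠ j → Disjoint (Set.Icc (l i) (u i)) (Set.Icc (l j) (u j))
  mem_disk : ∀ t ∈ Set.Icc (0 : ℝ) 1,
    (K.γ t ∈ f '' Metric.closedBall 0 1 ↔ ∃ i, t ∈ Set.Icc (l i) (u i))
  mem_interior : ∀ t ∈ Set.Icc (0 : ℝ) 1,
    (K.γ t ∈ f '' Metric.ball 0 1 ↔ ∃ i, t ∈ Set.Ioo (l i) (u i))

/-- `K` and `K'` both meet some disk in `m` arcs, on the time intervals `[l i, u i]`, and they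
coincide, with their over/under information, outside the interior of this disk. -/
def AgreeOutsideDisk (K K' : KnotoidDiagram) {m : ℕ} (l u : Fin m → ℝ) : Prop :=
  ∃ f : EuclideanSpace ℝ (Fin 2) → E3, IsDiskEmbedding f ∧
    K.MeetsDiskInArcs f l u ∧ K'.MeetsDiskInArcs f l u ∧
    (∀ t ∈ Set.Icc (0 : ℝ) 1, (∀ i, t ∉ Set.Ioo (l i) (u i)) → K.γ t = K'.γ t) ∧
    ∀ s t, K.IsDouble s t → (∀ i, s ∉ Set.Icc (l i) (u i)) → (K.passesOver s t ↔ K'.passesOver s t)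

/-- Two parameters of the diagram on the arcs `[l i, u i]` of a local picture at which the curve
passes through the same point. -/
def IsDoubleOn (K : KnotoidDiagram) {m : ℕ} (l u : Fin m → ℝ) (s t : ℝ) : Prop :=
  K.IsDouble s t ∧ (∃ i, s ∈ Set.Icc (l i) (u i)) ∧ ∃ i, t ∈ Set.Icc (l i) (u i)

/-- Reidemeister move I: an arc without crossings in a disk is replaced by
an arc with exactly one crossing (a curl), of any kind. -/
def ReidemeisterOne (K K' : KnotoidDiagram) : Prop :=
  ∃ l u : Fin 1 → ℝ, AgreeOutsideDisk K K' l u ∧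
    (∀ s t, ¬ K.IsDoubleOn l u s t) ∧
    ∃ p q, p ∈ Set.Ioo (l 0) (u 0) ∧ q ∈ Set.Ioo (l 0) (u 0) ∧ p ≠ q ∧
      ∀ s t, K'.IsDoubleOn l u s t ↔ s(s, t) = s(p, q)

/-- Reidemeister move II: two arcs without crossings in a disk are replaced by two arcs whose only
crossings are two crossings of opposite signs of the first arc with the second one, at both of which
the first arc passes over the second one. -/
def ReidemeisterTwo (K K' : KnotoidDiagram) : Prop :=
  ∃ l u : Fin 2 → ℝ, AgreeOutsideDisk K K' l u ∧
    (∀ s t, ¬ K.IsDoubleOn l u s t) ∧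
    ∃ p p' q q', p ∈ Set.Ioo (l 0) (u 0) ∧ p' ∈ Set.Ioo (l 0) (u 0) ∧ p ≠ p' ∧
      q ∈ Set.Ioo (l 1) (u 1) ∧ q' ∈ Set.Ioo (l 1) (u 1) ∧ q ≠ q' ∧
      (∀ s t, K'.IsDoubleOn l u s t ↔ s(s, t) = s(p, q) ∨ s(s, t) = s(p', q')) ∧
      K'.passesOver p q ∧ K'.passesOver p' q' ∧ K'.crossingSign p q = - K'.crossingSign p' q'

/-- In a disk, the diagram consists of a top, a middle and a bottom arc (on the time intervals
with index `0`, `1`, `2`), and any two of them cross exactly once, without further crossings.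
Here `p i j` is the time at which arc `i` crosses arc `j` (for `i ≠ j`). -/
structure IsTriangle (K : KnotoidDiagram) (l u : Fin 3 → ℝ) (p : Fin 3 → Fin 3 → ℝ) : Prop where
  mem : ∀ i j, i ≠ j → p i j ∈ Set.Ioo (l i) (u i)
  double : ∀ s t, K.IsDoubleOn l u s t ↔ ∃ i j, i ≠ j ∧ s = p i j ∧ t = p j i
  passesOver : ∀ i j, i < j → K.passesOver (p i j) (p j i)

/-- Reidemeister move III: three arcs in a disk that form a triangle, with a top, a middle and a
bottom arc, are replaced by three such arcs such that on each of the arcs the two crossings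
occur in the opposite order; corresponding crossings have the same sign. -/
def ReidemeisterThree (K K' : KnotoidDiagram) : Prop :=
  ∃ l u : Fin 3 → ℝ, AgreeOutsideDisk K K' l u ∧
    ∃ p p' : Fin 3 → Fin 3 → ℝ, K.IsTriangle l u p ∧ K'.IsTriangle l u p' ∧
      (∀ i j k, i ≠ j → i ≠ k → j ≠ k → (p i j < p i k ↔ p' i k < p' i j)) ∧
      ∀ i j, i ≠ j → K.crossingSign (p i j) (p j i) = K'.crossingSign (p' i j) (p' j i)

/-- A single planar isotopy, change of parameter, or Reidemeister move. -/
inductive Move : KnotoidDiagram → KnotoidDiagram → Prop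
  | planarIsotopy {K K' : KnotoidDiagram} : K.PlanarIsotopy K' → Move K K'
  | reparametrization {K K' : KnotoidDiagram} : K.Reparametrization K' → Move K K'
  | reidemeisterOne {K K' : KnotoidDiagram} : K.ReidemeisterOne K' → Move K K'
  | reidemeisterTwo {K K' : KnotoidDiagram} : K.ReidemeisterTwo K' → Move K K'
  | reidemeisterThree {K K' : KnotoidDiagram} : K.ReidemeisterThree K' → Move K K'

end KnotoidDiagram

/-- A knotoid: a class of knotoid diagrams up to planar isotopy and Reidemeister moves away from the
endpoints (the equivalence relation generated by these moves and their inverses). -/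
def Knotoid : Type := Quotient (Relation.EqvGen.setoid KnotoidDiagram.Move)

/-- The diagram `K` represents the knotoid `k`. -/
def KnotoidDiagram.Represents (K : KnotoidDiagram) (k : Knotoid) : Prop :=
  Quotient.mk (Relation.EqvGen.setoid KnotoidDiagram.Move) K = k

/-! ### Shortcuts and sign sequences -/

/-- A shortcut for `K`: a smoothly embedded path in `S²` from the tail to the head of `K` that meets
`K` (apart from the endpoints) in finitely many points, transversely and away from the crossings. -/
structure Shortcut (K : KnotoidDiagram) where
  /-- the embedded path -/
  a : ℝ → E3
  smooth : ContDiff ℝ ∞ a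
  mem_sphere : ∀ σ ∈ Set.Icc (0 : ℝ) 1, a σ ∈ S2
  immersed : ∀ σ ∈ Set.Icc (0 : ℝ) 1, deriv a σ ≠ 0
  injOn : Set.InjOn a (Set.Icc 0 1)
  tail : a 0 = K.γ 0
  head : a 1 = K.γ 1
  finite_inter : {τ : ℝ | τ ∈ Set.Ioo 0 1 ∧ ∃ σ ∈ Set.Ioo (0 : ℝ) 1, a σ = K.γ τ}.Finite
  transverse : ∀ σ ∈ Set.Ioo (0 : ℝ) 1, ∀ τ ∈ Set.Ioo (0 : ℝ) 1, a σ = K.γ τ →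
    LinearIndependent ℝ ![deriv a σ, deriv K.γ τ]
  avoids_crossings : ∀ σ ∈ Set.Icc (0 : ℝ) 1, ∀ s t, K.IsDouble s t → a σ ≠ K.γ s

open Classical in
/-- The sign of the intersection of `K` with the shortcut at time `τ` of `K`: it is `+1` when `K`
crosses the shortcut, directed from the tail to the head, from its right to its left
(counterclockwise around the tail), that is, when the directions of the shortcut and of `K`, in this
order, form a positive basis; otherwise it is `-1`. -/
noncomputable def Shortcut.sign {K : KnotoidDiagram} (S : Shortcut K) (τ : ℝ) : ℤˣ :=
  if ∃ σ ∈ Set.Ioo (0 : ℝ) 1, S.a σ = K.γ τ ∧ 0 < triple (K.γ τ) (deriv S.a σ) (deriv K.γ τ)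
  then 1 else -1

/-- The sign sequence of a shortcut diagram: the signs of the intersections, in the order in
which they appear along `K` from the tail to the head. -/
noncomputable def Shortcut.signSeq {K : KnotoidDiagram} (S : Shortcut K) : List ℤˣ :=
  (S.finite_inter.toFinset.sort (· ≤ ·)).map S.sign

/-- The sign sequence `A` is attainable for the knotoid `k`. -/
def Knotoid.Attainable (k : Knotoid) (A : List ℤˣ) : Prop :=
  ∃ (K : KnotoidDiagram) (S : Shortcut K), K.Represents k ∧ S.signSeq = A

/-- The sum of a sign sequence, `+` counting as `+1` and `-` as `-1`. -/
def signSum (B : List ℤˣ) : ℤ := (B.map fun ε : ℤˣ => (ε : ℤ)).sum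

/-! The index of a crossing can be read off from any shortcut: it is the intersection number of the
shortcut with the loop at the crossing (`Shortcut.index_eq_sum`). That loop occupies one interval of
time along the diagram, so the intersections on it are consecutive and their signs form a block of
the sign sequence (`Shortcut.exists_block`). For `n ≠ 0` the coefficient of `t ^ n` in the index
polynomial is the `n`-writhe (`coeff_indexPolynomial`), and a nonzero writhe requires a crossing of
index `n`. If the polynomial has positive maximal degree, this degree is therefore the index of a
crossing, hence a block sum; the same holds for a negative minimal degree. If the signed degree in
question is zero, the empty block serves.

The intersection formula is an argument principle. Stereographic projection from the head turns the
winding number around the axis into a planar winding number around the image of the tail, and sends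
the end of the shortcut to infinity, where the loop no longer winds. The difference of the two
winding numbers is the change of the argument of `ζ τ - α σ` along the boundary of a rectangle, and
each transverse intersection contributes one full turn (`HasBoundaryArgChange.of_simple_zeros`,
`argChange_sub_eq_sum`).

The given diagram may differ from the one that carries the shortcut, so the writhes of nonzero index
must be invariant under all moves (`Represents.indexPolynomial_eq`). Isotopies are handled by
homotopy invariance of the winding number. For a Reidemeister move, a logarithm of the position
exists on the disk of the move, so the index of a crossing in it depends only on the two arcs
involved (`AgreeOutsideDisk.exists_index`). -/

/-! ### Continuous logarithms and the change of the argument -/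

/-- A continuous nowhere vanishing function on a simply connected, locally path connected space has
a continuous logarithm. -/
theorem exists_continuous_log {X : Type*} [TopologicalSpace X] [SimplyConnectedSpace X]
    [LocallyPathConnectedSpace X] {g : X → ℂ} (hg : Continuous g) (h0 : ∀ x, g x ≠ 0) :
    ∃ L : X → ℂ, Continuous L ∧ ∀ x, Complex.exp (L x) = g x := by
  obtain ⟨x₀⟩ : Nonempty X := inferInstance
  obtain ⟨F, ⟨-, hF⟩, -⟩ := Complex.isCoveringMapOn_exp.existsUnique_continuousMap_lifts
    ⟨g, hg⟩ (a₀ := x₀) (e₀ := Complex.log (g x₀)) (Complex.exp_log (h0 x₀)) h0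
  exact ⟨F, F.continuous, fun x => congrFun hF x⟩

/-- A continuous nowhere vanishing function on a retract of a normed space has a continuous
logarithm. -/
theorem exists_continuousOn_log_of_retract {E : Type*} [NormedAddCommGroup E] [NormedSpace ℝ E]
    {s : Set E} (r : E → E) (hr : Continuous r) (hrs : ∀ x, r x ∈ s) (hid : ∀ x ∈ s, r x = x)
    {g : E → ℂ} (hg : ContinuousOn g s) (h0 : ∀ x ∈ s, g x ≠ 0) :
    ∃ L : E → ℂ, ContinuousOn L s ∧ ∀ x ∈ s, Complex.exp (L x) = g x := by
  obtain ⟨L, hL, hLg⟩ := exists_continuous_log (g := fun x => g (r x))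
    (hg.comp_continuous hr hrs) (fun x => h0 _ (hrs x))
  exact ⟨L, hL.continuousOn, fun x hx => by rw [hLg, hid x hx]⟩

theorem exists_continuousOn_log_Icc {a b : ℝ} (hab : a ≤ b) {g : ℝ → ℂ}
    (hg : ContinuousOn g (Set.Icc a b)) (h0 : ∀ x ∈ Set.Icc a b, g x ≠ 0) :
    ∃ L : ℝ → ℂ, ContinuousOn L (Set.Icc a b) ∧ ∀ x ∈ Set.Icc a b, Complex.exp (L x) = g x :=
  exists_continuousOn_log_of_retract (fun x : ℝ => (Set.projIcc a b hab x : ℝ))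
    (continuous_subtype_val.comp continuous_projIcc) (fun x => (Set.projIcc a b hab x).2)
    (fun x hx => by simp [Set.projIcc_of_mem hab hx]) hg h0

theorem exists_continuousOn_log_rectangle {a b c d : ℝ} (hab : a ≤ b) (hcd : c ≤ d)
    {g : ℝ × ℝ → ℂ} (hg : ContinuousOn g (Set.Icc a b ×ˢ Set.Icc c d))
    (h0 : ∀ x ∈ Set.Icc a b ×ˢ Set.Icc c d, g x ≠ 0) :
    ∃ L : ℝ × ℝ → ℂ, ContinuousOn L (Set.Icc a b ×ˢ Set.Icc c d) ∧
      ∀ x ∈ Set.Icc a b ×ˢ Set.Icc c d, Complex.exp (L x) = g x :=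
  exists_continuousOn_log_of_retract
    (fun x : ℝ × ℝ => ((Set.projIcc a b hab x.1 : ℝ), (Set.projIcc c d hcd x.2 : ℝ)))
    ((continuous_subtype_val.comp (continuous_projIcc.comp continuous_fst)).prodMk
      (continuous_subtype_val.comp (continuous_projIcc.comp continuous_snd)))
    (fun x => Set.mk_mem_prod (Set.projIcc a b hab x.1).2 (Set.projIcc c d hcd x.2).2)
    (fun x hx => by simp [Set.projIcc_of_mem hab hx.1, Set.projIcc_of_mem hcd hx.2]) hg h0

theorem exists_continuousOn_log_closedBall {E : Type*} [NormedAddCommGroup E] [NormedSpace ℝ E]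
    {g : E → ℂ} (hg : ContinuousOn g (Metric.closedBall 0 1))
    (h0 : ∀ x ∈ Metric.closedBall (0 : E) 1, g x ≠ 0) :
    ∃ L : E → ℂ, ContinuousOn L (Metric.closedBall 0 1) ∧
      ∀ x ∈ Metric.closedBall (0 : E) 1, Complex.exp (L x) = g x := by
  have hpos : ∀ x : E, 0 < max 1 ‖x‖ := fun x => lt_of_lt_of_le one_pos (le_max_left _ _)
  refine exists_continuousOn_log_of_retract (fun x => (max 1 ‖x‖)⁻¹ • x) ?_ ?_ ?_ hg h0
  · exact ((continuous_const.max continuous_norm).inv₀ fun x => (hpos x).ne').smul continuous_id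
  · intro x
    rw [mem_closedBall_zero_iff, norm_smul, norm_inv, Real.norm_of_nonneg (hpos x).le,
      inv_mul_le_iff₀ (hpos x), mul_one]
    exact le_max_right _ _
  · intro x hx
    rw [mem_closedBall_zero_iff] at hx
    simp [max_eq_left hx]

/-- An open interval is not closed, hence no retract of the line; here the interval itself serves as
the simply connected domain. -/
theorem exists_continuousOn_log_Ioo {a b : ℝ} (hab : a < b) {g : ℝ → ℂ}
    (hg : ContinuousOn g (Set.Ioo a b)) (h0 : ∀ x ∈ Set.Ioo a b, g x ≠ 0) :
    ∃ L : ℝ → ℂ, ContinuousOn L (Set.Ioo a b) ∧ ∀ x ∈ Set.Ioo a b, Complex.exp (L x) = g x := by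
  have : ContractibleSpace (Set.Ioo a b) :=
    (convex_Ioo a b).contractibleSpace (Set.nonempty_Ioo.2 hab)
  have hsc : IsSimplyConnected (Set.Ioo a b) := by
    unfold IsSimplyConnected; infer_instance
  obtain ⟨L, hL, hLg⟩ := Complex.exists_continuousOn_eqOn_exp_comp hsc isOpen_Ioo hg
    (by rintro ⟨x, hx, h⟩; exact h0 x hx h)
  exact ⟨L, hL, hLg⟩

/-- Two continuous logarithms on a preconnected set differ by a constant. -/
theorem log_sub_const {X : Type*} [TopologicalSpace X] {S : Set X} (hS : IsPreconnected S)
    {L M : X → ℂ} (hL : ContinuousOn L S) (hM : ContinuousOn M S)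
    (h : ∀ x ∈ S, Complex.exp (L x) = Complex.exp (M x)) {x y : X} (hx : x ∈ S) (hy : y ∈ S) :
    L x - M x = L y - M y := by
  have hint : ∀ z ∈ S, ∃ n : ℤ, L z - M z = n * (2 * Real.pi * Complex.I) := by
    intro z hz
    obtain ⟨n, hn⟩ := Complex.exp_eq_exp_iff_exists_int.1 (h z hz)
    exact ⟨n, by rw [hn]; ring⟩
  have him : ∀ z ∈ S, ∃ n : ℤ, (L z - M z).im / (2 * Real.pi) = n := by
    intro z hz
    obtain ⟨n, hn⟩ := hint z hz
    refine ⟨n, ?_⟩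
    have : (L z - M z).im = n * (2 * Real.pi) := by
      rw [hn]; simp
    rw [this]; field_simp
  have hc : ContinuousOn (fun z => (L z - M z).im / (2 * Real.pi)) S :=
    (Complex.continuous_im.comp_continuousOn (hL.sub hM)).div_const _
  have hre : ∀ z ∈ S, (L z - M z).re = 0 := by
    intro z hz
    obtain ⟨n, hn⟩ := hint z hz
    rw [hn]; simp
  -- The difference divided by `2πi` is continuous with values in the discrete set of integers, so
  -- it is constant on a preconnected set.
  have key := hS.constant_of_mapsTo (T := Set.range ((↑) : ℤ → ℝ))
    (f := fun z => (L z - M z).im / (2 * Real.pi)) 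
    Int.isClosedEmbedding_coe_real.isEmbedding.isInducing.isDiscrete_range hc
    (fun z hz => by obtain ⟨n, hn⟩ := him z hz; exact ⟨n, hn.symm⟩) hx hy
  have hpi : (2 * Real.pi) ≠ 0 := by positivity
  apply Complex.ext
  · rw [hre x hx, hre y hy]
  · have := key
    field_simp at this
    exact this

/-- The argument of `g` changes by `δ` along the interval `[s, t]`. -/
def HasArgChange (g : ℝ → ℂ) (s t δ : ℝ) : Prop :=
  ∃ L : ℝ → ℂ, ContinuousOn L (Set.Icc s t) ∧ (∀ τ ∈ Set.Icc s t, Complex.exp (L τ) = g τ) ∧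
    (L t - L s).im = δ

namespace HasArgChange

variable {g h : ℝ → ℂ} {s t δ ε : ℝ}

theorem unique (hst : s ≤ t) (h₁ : HasArgChange g s t δ) (h₂ : HasArgChange g s t ε) : δ = ε := by
  obtain ⟨L, hL, hLg, rfl⟩ := h₁
  obtain ⟨M, hM, hMg, rfl⟩ := h₂
  have := log_sub_const (isPreconnected_Icc) hL hM (fun x hx => by rw [hLg x hx, hMg x hx])
    (Set.left_mem_Icc.2 hst) (Set.right_mem_Icc.2 hst)
  have h2 : L t - L s = M t - M s := by linear_combination -this
  rw [h2]

theorem exists_of_ne_zero (hst : s ≤ t) (hg : ContinuousOn g (Set.Icc s t))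
    (h0 : ∀ τ ∈ Set.Icc s t, g τ ≠ 0) : ∃ δ, HasArgChange g s t δ := by
  obtain ⟨L, hL, hLg⟩ := exists_continuousOn_log_Icc hst hg h0
  exact ⟨_, L, hL, hLg, rfl⟩

theorem mul (hg : HasArgChange g s t δ) (hh : HasArgChange h s t ε) :
    HasArgChange (fun τ => g τ * h τ) s t (δ + ε) := by
  obtain ⟨L, hL, hLg, rfl⟩ := hg
  obtain ⟨M, hM, hMg, rfl⟩ := hh
  refine ⟨fun τ => L τ + M τ, hL.add hM, fun τ hτ => ?_, ?_⟩
  · rw [Complex.exp_add, hLg τ hτ, hMg τ hτ]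
  · simp only [Complex.sub_im, Complex.add_im]; ring

theorem congr (hg : HasArgChange g s t δ) (hgh : ∀ τ ∈ Set.Icc s t, h τ = g τ) :
    HasArgChange h s t δ := by
  obtain ⟨L, hL, hLg, rfl⟩ := hg
  exact ⟨L, hL, fun τ hτ => by rw [hLg τ hτ, hgh τ hτ], rfl⟩

theorem const {c : ℂ} (hc : c ≠ 0) : HasArgChange (fun _ => c) s t 0 :=
  ⟨fun _ => Complex.log c, continuousOn_const, fun _ _ => Complex.exp_log hc, by simp⟩

theorem const_mul {c : ℂ} (hc : c ≠ 0) (hg : HasArgChange g s t δ) :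
    HasArgChange (fun τ => c * g τ) s t δ := by
  simpa using (HasArgChange.const hc).mul hg

theorem of_mem_slitPlane (hg : ContinuousOn g (Set.Icc s t))
    (h : ∀ τ ∈ Set.Icc s t, g τ ∈ Complex.slitPlane) :
    HasArgChange g s t ((g t).arg - (g s).arg) :=
  ⟨fun τ => Complex.log (g τ), hg.clog h,
    fun τ hτ => Complex.exp_log (Complex.slitPlane_ne_zero (h τ hτ)),
    by simp [Complex.log_im]⟩

/-- A closed curve that is never opposite to another closed curve has the same change of the
argument. -/
theorem of_div_mem_slitPlane (hg : HasArgChange g s t δ)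
    (hgc : ContinuousOn g (Set.Icc s t))
    (hh : ContinuousOn h (Set.Icc s t)) (hq : ∀ τ ∈ Set.Icc s t, h τ / g τ ∈ Complex.slitPlane)
    (hgs : g s = g t) (hhs : h s = h t) : HasArgChange h s t δ := by
  have h0 : ∀ τ ∈ Set.Icc s t, g τ ≠ 0 := by
    obtain ⟨L, hL, hLg, rfl⟩ := hg
    intro τ hτ; rw [← hLg τ hτ]; exact Complex.exp_ne_zero _
  -- The quotient has a continuous principal argument, which returns to its initial value because
  -- both curves are closed.
  have h1 := of_mem_slitPlane (hh.div hgc h0) hq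
  have h2 := h1.mul hg
  rw [show ((h / g) t).arg - ((h / g) s).arg = 0 by simp [hgs, hhs], zero_add] at h2
  exact h2.congr fun τ hτ => (div_mul_cancel₀ _ (h0 τ hτ)).symm

end HasArgChange

/-- The argument of `g` changes by `δ` along the boundary of the rectangle `[a, b] × [c, d]`,
counterclockwise. -/
def HasBoundaryArgChange (g : ℝ × ℝ → ℂ) (a b c d δ : ℝ) : Prop :=
  ∃ δb δr δt δl : ℝ, HasArgChange (fun x => g (x, c)) a b δb ∧
    HasArgChange (fun y => g (b, y)) c d δr ∧ HasArgChange (fun x => g (x, d)) a b δt ∧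
    HasArgChange (fun y => g (a, y)) c d δl ∧ δ = δb + δr - δt - δl

namespace HasBoundaryArgChange

variable {g h : ℝ × ℝ → ℂ} {a b c d δ ε : ℝ}

theorem mul (hg : HasBoundaryArgChange g a b c d δ) (hh : HasBoundaryArgChange h a b c d ε) :
    HasBoundaryArgChange (fun x => g x * h x) a b c d (δ + ε) := by
  obtain ⟨δb, δr, δt, δl, h1, h2, h3, h4, rfl⟩ := hg
  obtain ⟨εb, εr, εt, εl, k1, k2, k3, k4, rfl⟩ := hh
  exact ⟨_, _, _, _, h1.mul k1, h2.mul k2, h3.mul k3, h4.mul k4, by ring⟩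

/-- A logarithm on the whole rectangle turns the four changes into differences of its values at the
corners, and these cancel around the boundary. -/
theorem of_ne_zero (hab : a ≤ b) (hcd : c ≤ d) (hg : ContinuousOn g (Set.Icc a b ×ˢ Set.Icc c d))
    (h0 : ∀ x ∈ Set.Icc a b ×ˢ Set.Icc c d, g x ≠ 0) : HasBoundaryArgChange g a b c d 0 := by
  obtain ⟨L, hL, hLg⟩ := exists_continuousOn_log_rectangle hab hcd hg h0
  have hx : ∀ y ∈ Set.Icc c d, HasArgChange (fun x => g (x, y)) a b (L (b, y) - L (a, y)).im :=
    fun y hy => ⟨fun x => L (x, y), hL.comp (by fun_prop) fun x hx => ⟨hx, hy⟩,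
      fun x hx => hLg _ ⟨hx, hy⟩, rfl⟩
  have hy : ∀ x ∈ Set.Icc a b, HasArgChange (fun y => g (x, y)) c d (L (x, d) - L (x, c)).im :=
    fun x hx => ⟨fun y => L (x, y), hL.comp (by fun_prop) fun y hy => ⟨hx, hy⟩,
      fun y hy => hLg _ ⟨hx, hy⟩, rfl⟩
  refine ⟨_, _, _, _, hx c (Set.left_mem_Icc.2 hcd), hy b (Set.right_mem_Icc.2 hab),
    hx d (Set.right_mem_Icc.2 hcd), hy a (Set.left_mem_Icc.2 hab), ?_⟩
  simp only [Complex.sub_im]; ring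

theorem congr (hg : HasBoundaryArgChange g a b c d δ) (hab : a ≤ b) (hcd : c ≤ d)
    (hgh : ∀ x ∈ Set.Icc a b ×ˢ Set.Icc c d, (x.1 = a ∨ x.1 = b ∨ x.2 = c ∨ x.2 = d) → h x = g x) :
    HasBoundaryArgChange h a b c d δ := by
  obtain ⟨δb, δr, δt, δl, h1, h2, h3, h4, rfl⟩ := hg
  exact ⟨_, _, _, _, h1.congr fun x hx => hgh _ ⟨hx, Set.left_mem_Icc.2 hcd⟩ (by simp),
    h2.congr fun x hx => hgh _ ⟨Set.right_mem_Icc.2 hab, hx⟩ (by simp),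
    h3.congr fun x hx => hgh _ ⟨hx, Set.right_mem_Icc.2 hcd⟩ (by simp),
    h4.congr fun x hx => hgh _ ⟨Set.left_mem_Icc.2 hab, hx⟩ (by simp), rfl⟩

end HasBoundaryArgChange

/-- The change of the argument of a closed homotopy of closed curves is constant. -/
theorem HasArgChange.homotopy {G : ℝ × ℝ → ℂ} {a b c d δ ε : ℝ} (hab : a ≤ b) (hcd : c ≤ d)
    (hG : ContinuousOn G (Set.Icc a b ×ˢ Set.Icc c d))
    (h0 : ∀ x ∈ Set.Icc a b ×ˢ Set.Icc c d, G x ≠ 0)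
    (hclosed : ∀ x ∈ Set.Icc a b, G (x, c) = G (x, d))
    (hδ : HasArgChange (fun y => G (a, y)) c d δ) (hε : HasArgChange (fun y => G (b, y)) c d ε) :
    δ = ε := by
  -- The curves of the homotopy are closed, so the bottom and top sides contribute equally and
  -- cancel.
  obtain ⟨δb, δr, δt, δl, h1, h2, h3, h4, h5⟩ := HasBoundaryArgChange.of_ne_zero hab hcd hG h0
  have e1 := h1.unique hab (h3.congr hclosed)
  have e2 := h2.unique hcd hε
  have e3 := h4.unique hcd hδ
  linarith

/-! ### The argument principle on a rectangle -/

/-- The real affine function `(x - x₀) + (y - y₀) C` of `(x, y)`. -/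
noncomputable def affineFactor (z : ℝ × ℝ) (C : ℂ) (w : ℝ × ℝ) : ℂ :=
  ((w.1 - z.1 : ℝ) : ℂ) + ((w.2 - z.2 : ℝ) : ℂ) * C

theorem affineFactor_im (z : ℝ × ℝ) (C : ℂ) (w : ℝ × ℝ) :
    (affineFactor z C w).im = (w.2 - z.2) * C.im := by
  simp only [affineFactor, Complex.add_im, Complex.ofReal_im,
    Complex.im_ofReal_mul, zero_add]

theorem affineFactor_re (z : ℝ × ℝ) (C : ℂ) (w : ℝ × ℝ) :
    (affineFactor z C w).re = (w.1 - z.1) + (w.2 - z.2) * C.re := by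
  simp only [affineFactor, Complex.add_re, Complex.ofReal_re, Complex.re_ofReal_mul]

theorem continuous_affineFactor (z : ℝ × ℝ) (C : ℂ) : Continuous (affineFactor z C) := by
  unfold affineFactor; fun_prop

theorem affineFactor_ne_zero {z : ℝ × ℝ} {C : ℂ} (hC : C.im ≠ 0) {w : ℝ × ℝ} (hw : w ≠ z) :
    affineFactor z C w ≠ 0 := by
  intro h
  have h1 := affineFactor_im z C w
  have h2 := affineFactor_re z C w
  rw [h] at h1 h2
  have h3 : w.2 - z.2 = 0 := by
    rcases mul_eq_zero.1 h1.symm with h3 | h3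
    · exact h3
    · exact absurd h3 hC
  rw [h3] at h2
  simp only [Complex.zero_re, zero_mul, add_zero] at h2
  exact hw (Prod.ext (by linarith) (by linarith))

theorem abs_snd_le_norm_affineFactor (z : ℝ × ℝ) (C : ℂ) (w : ℝ × ℝ) :
    |w.2 - z.2| * |C.im| ≤ ‖affineFactor z C w‖ := by
  rw [← abs_mul, ← affineFactor_im]
  exact Complex.abs_im_le_norm _

/-- Together with `abs_snd_le_norm_affineFactor` this bounds both coordinates of `w - z` by the
affine factor, so an error that is small relative to either coordinate is small relative to the
factor. -/
theorem abs_fst_le_norm_affineFactor {z : ℝ × ℝ} {C : ℂ} (hC : C.im ≠ 0) (w : ℝ × ℝ) :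
    |w.1 - z.1| ≤ (1 + ‖C‖ / |C.im|) * ‖affineFactor z C w‖ := by
  have h1 := abs_snd_le_norm_affineFactor z C w
  have hpos : 0 < |C.im| := abs_pos.2 hC
  have h2 : |w.2 - z.2| ≤ ‖affineFactor z C w‖ / |C.im| := by
    rwa [le_div_iff₀ hpos]
  have h3 : |w.1 - z.1| ≤ ‖affineFactor z C w‖ + |w.2 - z.2| * ‖C‖ := by
    have : ((w.1 - z.1 : ℝ) : ℂ) = affineFactor z C w - ((w.2 - z.2 : ℝ) : ℂ) * C := by
      rw [affineFactor]; ring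
    calc |w.1 - z.1| = ‖((w.1 - z.1 : ℝ) : ℂ)‖ := by rw [Complex.norm_real, Real.norm_eq_abs]
      _ ≤ _ := by
        rw [this]
        refine (norm_sub_le _ _).trans ?_
        rw [norm_mul, Complex.norm_real, Real.norm_eq_abs]
  calc |w.1 - z.1| ≤ ‖affineFactor z C w‖ + |w.2 - z.2| * ‖C‖ := h3
    _ ≤ ‖affineFactor z C w‖ + ‖affineFactor z C w‖ / |C.im| * ‖C‖ := by gcongr
    _ = _ := by ring

/-- On the bottom, top and right sides the factor avoids the closed negative real axis, so principal
arguments apply. The left side meets that axis, and there the negative of the factor is used. The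
arguments at the corners cancel except for two shifts by `π` on the left side, which add up to one
full turn. -/
theorem hasBoundaryArgChange_affineFactor {a b c d : ℝ} {z : ℝ × ℝ} {C : ℂ} (hC : C.im ≠ 0)
    (h1 : z.1 ∈ Set.Ioo a b) (h2 : z.2 ∈ Set.Ioo c d) :
    HasBoundaryArgChange (affineFactor z C) a b c d
      (2 * Real.pi * ((SignType.sign C.im : ℤ) : ℝ)) := by
  have hcont := continuous_affineFactor z C
  have him : ∀ w : ℝ × ℝ, w.2 ≠ z.2 → affineFactor z C w ∈ Complex.slitPlane := by
    intro w hw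
    refine Complex.mem_slitPlane_iff.2 (Or.inr ?_)
    rw [affineFactor_im]
    exact mul_ne_zero (sub_ne_zero.2 hw) hC
  have hb := HasArgChange.of_mem_slitPlane (g := fun x => affineFactor z C (x, c)) (s := a) (t := b)
    (hcont.comp (by fun_prop)).continuousOn (fun τ _ => him _ h2.1.ne)
  have ht := HasArgChange.of_mem_slitPlane (g := fun x => affineFactor z C (x, d)) (s := a) (t := b)
    (hcont.comp (by fun_prop)).continuousOn (fun τ _ => him _ h2.2.ne')
  have hr := HasArgChange.of_mem_slitPlane (g := fun y => affineFactor z C (b, y)) (s := c) (t := d)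
    (hcont.comp (by fun_prop)).continuousOn (fun τ _ => by
      by_cases hτ : τ = z.2
      · refine Or.inl ?_
        rw [affineFactor_re]; simp [hτ, h1.2]
      · exact him _ hτ)
  have hl := HasArgChange.of_mem_slitPlane (g := fun y => (-1) * affineFactor z C (a, y)) (s := c)
    (t := d) (continuous_const.mul (hcont.comp (by fun_prop))).continuousOn (fun τ _ => by
      by_cases hτ : τ = z.2
      · refine Or.inl ?_
        rw [neg_one_mul, Complex.neg_re, affineFactor_re]; simp [hτ, h1.1]
      · refine Complex.mem_slitPlane_iff.2 (Or.inr ?_)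
        rw [neg_one_mul, Complex.neg_im, affineFactor_im]
        exact neg_ne_zero.2 (mul_ne_zero (sub_ne_zero.2 hτ) hC))
  have hl' := (hl.const_mul (c := -1) (by simp)).congr (h := fun y => affineFactor z C (a, y))
    (fun τ _ => by ring)
  refine ⟨_, _, _, _, hb, hr, ht, hl', ?_⟩
  simp only [neg_one_mul]
  have hd := affineFactor_im z C (a, d)
  have hc := affineFactor_im z C (a, c)
  rcases lt_or_gt_of_ne hC with hneg | hpos
  · rw [Complex.arg_neg_eq_arg_add_pi_of_im_neg (x := affineFactor z C (a, d))
      (by rw [hd]; exact mul_neg_of_pos_of_neg (sub_pos.2 h2.2) hneg),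
      Complex.arg_neg_eq_arg_sub_pi_of_im_pos (x := affineFactor z C (a, c))
      (by rw [hc]; exact mul_pos_of_neg_of_neg (sub_neg.2 h2.1) hneg), sign_neg hneg]
    simp; ring
  · rw [Complex.arg_neg_eq_arg_sub_pi_of_im_pos (x := affineFactor z C (a, d))
      (by rw [hd]; exact mul_pos (sub_pos.2 h2.2) hpos),
      Complex.arg_neg_eq_arg_add_pi_of_im_neg (x := affineFactor z C (a, c))
      (by rw [hc]; exact mul_neg_of_neg_of_pos (sub_neg.2 h2.1) hpos), sign_pos hpos]
    simp; ring

open Filter Topology in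
/-- The argument principle for functions with finitely many zeros on a rectangle, at each of which
the function is asymptotic to a multiple of an invertible real affine function. -/
theorem HasBoundaryArgChange.of_simple_zeros {a b c d : ℝ} (hab : a ≤ b) (hcd : c ≤ d)
    (C : ℝ × ℝ → ℂ) (Z : Finset (ℝ × ℝ)) :
    (∀ z ∈ Z, z.1 ∈ Set.Ioo a b ∧ z.2 ∈ Set.Ioo c d) → (∀ z ∈ Z, (C z).im ≠ 0) →
    ∀ H : ℝ × ℝ → ℂ, ContinuousOn H (Set.Icc a b ×ˢ Set.Icc c d) →
    (∀ w ∈ Set.Icc a b ×ˢ Set.Icc c d, w ∉ Z → H w ≠ 0) →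
    (∀ z ∈ Z, ∃ k : ℂ, k ≠ 0 ∧
      Tendsto (fun w => H w / affineFactor z (C z) w) (𝓝[≠] z) (𝓝 k)) →
    HasBoundaryArgChange H a b c d
      (∑ z ∈ Z, 2 * Real.pi * ((SignType.sign (C z).im : ℤ) : ℝ)) := by
  classical
  induction Z using Finset.induction_on with
  | empty =>
    intro _ _ H hH h0 _
    simpa using HasBoundaryArgChange.of_ne_zero hab hcd hH fun x hx => h0 x hx (by simp)
  | insert z₀ Z hz₀ ih =>
    intro hZ hC H hH h0 hlim
    obtain ⟨k, hk, hlimk⟩ := hlim z₀ (Finset.mem_insert_self _ _)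
    have hC₀ := hC z₀ (Finset.mem_insert_self _ _)
    have hZ₀ := hZ z₀ (Finset.mem_insert_self _ _)
    set P := affineFactor z₀ (C z₀) with hP
    have hPc : Continuous P := continuous_affineFactor _ _
    have hP0 : ∀ w, w ≠ z₀ → P w ≠ 0 := fun w hw => affineFactor_ne_zero hC₀ hw
    -- Divide out the factor at `z₀` and fill in the limit `k`: the quotient is continuous and loses
    -- this zero, while at every other zero its leading behaviour changes only by the nonzero
    -- constant `P z`.
    have key := ih (fun z hz => hZ z (Finset.mem_insert_of_mem hz))
      (fun z hz => hC z (Finset.mem_insert_of_mem hz)) (Function.update (fun w => H w / P w) z₀ k)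
      ?_ ?_ ?_
    · rw [Finset.sum_insert hz₀, add_comm]
      refine (key.mul (hasBoundaryArgChange_affineFactor hC₀ hZ₀.1 hZ₀.2)).congr hab hcd ?_
      intro w _ hbd
      have hw : w ≠ z₀ := by
        rintro rfl
        obtain ⟨⟨h1, h2⟩, h3, h4⟩ := hZ₀
        rcases hbd with h | h | h | h <;> linarith
      rw [Function.update_of_ne hw, div_mul_cancel₀ _ (hP0 w hw)]
    · intro w hw
      by_cases hwz : w = z₀
      · subst hwz
        exact (continuousAt_update_same.2 hlimk).continuousWithinAt
      · refine ((hH w hw).div hPc.continuousWithinAt (hP0 w hwz)).congr_of_eventuallyEq ?_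
          (by rw [Function.update_of_ne hwz]; rfl)
        filter_upwards [mem_nhdsWithin_of_mem_nhds (isOpen_ne.mem_nhds hwz)] with x hx
        rw [Function.update_of_ne hx]; rfl
    · intro w hw hwZ
      by_cases hwz : w = z₀
      · rw [hwz, Function.update_self]; exact hk
      · rw [Function.update_of_ne hwz]
        exact div_ne_zero (h0 w hw (by simp [hwz, hwZ])) (hP0 w hwz)
    · intro z hz
      have hzz : z ≠ z₀ := by rintro rfl; exact hz₀ hz
      obtain ⟨k', hk', hlim'⟩ := hlim z (Finset.mem_insert_of_mem hz)
      refine ⟨k' / P z, div_ne_zero hk' (hP0 z hzz), ?_⟩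
      refine (hlim'.div (hPc.continuousAt.mono_left nhdsWithin_le_nhds) (hP0 z hzz)).congr' ?_
      filter_upwards [mem_nhdsWithin_of_mem_nhds (isOpen_ne.mem_nhds hzz)] with x hx
      rw [Function.update_of_ne hx]
      exact div_right_comm _ _ _

open Filter Topology Asymptotics in
/-- The difference of two plane curves that cross transversely is asymptotic to a multiple of an
affine factor. -/
theorem tendsto_sub_div_affineFactor {α ζ : ℝ → ℂ} {σ₀ τ₀ : ℝ} {A B : ℂ}
    (hα : HasDerivAt α A σ₀) (hζ : HasDerivAt ζ B τ₀) (h : α σ₀ = ζ τ₀)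
    (hA : A ≠ 0) (hAB : (-(B / A)).im ≠ 0) :
    Tendsto (fun w : ℝ × ℝ => (ζ w.2 - α w.1) / affineFactor (σ₀, τ₀) (-(B / A)) w)
      (𝓝[≠] (σ₀, τ₀)) (𝓝 (-A)) := by
  set P := affineFactor (σ₀, τ₀) (-(B / A)) with hP
  have h1 : (fun w : ℝ × ℝ => α w.1 - α σ₀ - (w.1 - σ₀) • A) =o[𝓝[≠] (σ₀, τ₀)] P := by
    have := (hasDerivAt_iff_isLittleO.1 hα).comp_tendsto
      (k := fun w : ℝ × ℝ => w.1) (l' := 𝓝[≠] (σ₀, τ₀))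
      (continuous_fst.continuousAt.mono_left nhdsWithin_le_nhds)
    refine this.trans_isBigO ?_
    refine IsBigO.of_bound (1 + ‖-(B / A)‖ / |(-(B / A)).im|) (Eventually.of_forall fun w => ?_)
    exact abs_fst_le_norm_affineFactor (z := (σ₀, τ₀)) hAB w
  have h2 : (fun w : ℝ × ℝ => ζ w.2 - ζ τ₀ - (w.2 - τ₀) • B) =o[𝓝[≠] (σ₀, τ₀)] P := by
    have := (hasDerivAt_iff_isLittleO.1 hζ).comp_tendsto
      (k := fun w : ℝ × ℝ => w.2) (l' := 𝓝[≠] (σ₀, τ₀))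
      (continuous_snd.continuousAt.mono_left nhdsWithin_le_nhds)
    refine this.trans_isBigO ?_
    refine IsBigO.of_bound (1 / |(-(B / A)).im|) (Eventually.of_forall fun w => ?_)
    rw [one_div, ← div_eq_inv_mul, le_div_iff₀ (abs_pos.2 hAB)]
    exact abs_snd_le_norm_affineFactor (σ₀, τ₀) _ w
  have h3 := (h2.sub h1).tendsto_div_nhds_zero
  have h4 : Tendsto (fun w : ℝ × ℝ => -A + ((ζ w.2 - ζ τ₀ - (w.2 - τ₀) • B) -
      (α w.1 - α σ₀ - (w.1 - σ₀) • A)) / P w) (𝓝[≠] (σ₀, τ₀)) (𝓝 (-A + 0)) :=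
    tendsto_const_nhds.add h3
  rw [add_zero] at h4
  refine h4.congr' ?_
  filter_upwards [self_mem_nhdsWithin] with w hw
  have hPw : P w ≠ 0 := affineFactor_ne_zero hAB hw
  -- Since `-A * P` is `(τ - τ₀) B - (σ - σ₀) A`, the numerator is `-A * P` plus the two first-order
  -- errors.
  rw [← mul_div_cancel_right₀ (-A) hPw, ← add_div]
  congr 1
  rw [hP, affineFactor, h]
  simp only [Complex.real_smul]
  field_simp
  push_cast
  ring

/-- The winding numbers of a closed plane curve around two points differ by the number of
intersections, counted with signs, with a path that joins these points. -/
theorem argChange_sub_eq_sum {α ζ : ℝ → ℂ} {a b s t δa δb : ℝ} (hab : a ≤ b) (hst : s ≤ t)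
    (hα : ContinuousOn α (Set.Icc a b)) (hζ : ContinuousOn ζ (Set.Icc s t)) (hclosed : ζ s = ζ t)
    (Z : Finset (ℝ × ℝ)) (hZ : ∀ z ∈ Z, z.1 ∈ Set.Ioo a b ∧ z.2 ∈ Set.Ioo s t)
    (h0 : ∀ σ ∈ Set.Icc a b, ∀ τ ∈ Set.Icc s t, α σ = ζ τ → (σ, τ) ∈ Z)
    (A B : ℝ × ℝ → ℂ) (hZ0 : ∀ z ∈ Z, α z.1 = ζ z.2)
    (hA : ∀ z ∈ Z, HasDerivAt α (A z) z.1) (hB : ∀ z ∈ Z, HasDerivAt ζ (B z) z.2)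
    (hAB : ∀ z ∈ Z, ((starRingEnd ℂ) (A z) * B z).im ≠ 0)
    (ha : HasArgChange (fun τ => ζ τ - α a) s t δa)
    (hb : HasArgChange (fun τ => ζ τ - α b) s t δb) :
    δa - δb = 2 * Real.pi *
      ((∑ z ∈ Z, (SignType.sign ((starRingEnd ℂ) (A z) * B z).im : ℤ) : ℤ) : ℝ) := by
  have hA0 : ∀ z ∈ Z, A z ≠ 0 := by
    intro z hz h; apply hAB z hz; simp [h]
  have him : ∀ z ∈ Z, (-(B z / A z)).im =
      -(((starRingEnd ℂ) (A z) * B z).im * (Complex.normSq (A z))⁻¹) := by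
    intro z hz
    rw [Complex.neg_im, div_eq_mul_inv, Complex.inv_def]
    rw [← mul_assoc, mul_comm (B z), Complex.im_mul_ofReal]
  have hns : ∀ z ∈ Z, 0 < (Complex.normSq (A z))⁻¹ := fun z hz =>
    inv_pos.2 (Complex.normSq_pos.2 (hA0 z hz))
  have him0 : ∀ z ∈ Z, (-(B z / A z)).im ≠ 0 := by
    intro z hz
    rw [him z hz]
    exact neg_ne_zero.2 (mul_ne_zero (hAB z hz) (hns z hz).ne')
  have hsign : ∀ z ∈ Z, SignType.sign (-(B z / A z)).im =
      - SignType.sign ((starRingEnd ℂ) (A z) * B z).im := by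
    intro z hz
    rw [him z hz, Left.sign_neg, sign_mul, sign_pos (hns z hz), mul_one]
  -- On the vertical sides of the rectangle `ζ τ - α σ` gives the two winding numbers; the
  -- horizontal sides cancel because `ζ` is closed. The factor at a zero has slope `-(B / A)`, whose
  -- imaginary part has the sign opposite to that of the intersection.
  obtain ⟨δ₁, δ₂, δ₃, δ₄, h1, h2, h3, h4, h5⟩ := HasBoundaryArgChange.of_simple_zeros hab hst
    (fun z => -(B z / A z)) Z hZ him0 (fun w => ζ w.2 - α w.1)
    ((hζ.comp continuousOn_snd fun w hw => hw.2).sub (hα.comp continuousOn_fst fun w hw => hw.1))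
    (fun w hw hwZ h => hwZ (h0 w.1 hw.1 w.2 hw.2 (sub_eq_zero.1 h).symm))
    (fun z hz => ⟨-A z, neg_ne_zero.2 (hA0 z hz),
      tendsto_sub_div_affineFactor (hA z hz) (hB z hz) (hZ0 z hz) (hA0 z hz) (him0 z hz)⟩)
  have e1 : δ₁ = δ₃ := h1.unique hab (h3.congr fun x _ => by simp [hclosed])
  have e2 := h2.unique hst hb
  have e3 := h4.unique hst ha
  rw [Finset.sum_congr rfl fun z hz => by rw [hsign z hz]] at h5
  have h6 : ∑ z ∈ Z, 2 * Real.pi *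
      (((-SignType.sign ((starRingEnd ℂ) (A z) * B z).im : SignType) : ℤ) : ℝ) =
      -(2 * Real.pi *
      ((∑ z ∈ Z, (SignType.sign ((starRingEnd ℂ) (A z) * B z).im : ℤ) : ℤ) : ℝ)) := by
    rw [← Finset.mul_sum, ← mul_neg, Int.cast_sum, ← Finset.sum_neg_distrib]
    congr 1
    refine Finset.sum_congr rfl fun z _ => ?_
    cases SignType.sign ((starRingEnd ℂ) (A z) * B z).im <;> simp
  rw [h6] at h5
  linarith

/-! ### Positive orthonormal frames of three-space -/

theorem inner_eq_coord (x y : E3) : inner ℝ x y = x 0 * y 0 + x 1 * y 1 + x 2 * y 2 := by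
  simp [PiLp.inner_apply, Fin.sum_univ_three]; ring

theorem triple_eq_coord (x u v : E3) : triple x u v =
    x 0 * (u 1 * v 2 - u 2 * v 1) - x 1 * (u 0 * v 2 - u 2 * v 0) +
      x 2 * (u 0 * v 1 - u 1 * v 0) := by
  simp [triple, Matrix.det_fin_three]; ring

theorem inner_self_of_mem_S2 {x : E3} (hx : x ∈ S2) : inner ℝ x x = 1 := by
  rw [real_inner_self_eq_norm_sq, mem_sphere_zero_iff_norm.1 hx, one_pow]

/-- `(n, e₁, e₂)` is a positive orthonormal basis of three-space. -/
structure IsFrame (n e₁ e₂ : E3) : Prop where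
  nn : inner ℝ n n = 1
  one : inner ℝ e₁ e₁ = 1
  two : inner ℝ e₂ e₂ = 1
  n1 : inner ℝ n e₁ = 0
  n2 : inner ℝ n e₂ = 0
  one_two : inner ℝ e₁ e₂ = 0
  triple_eq : triple n e₁ e₂ = 1

/-- The product of two determinants is the determinant of the matrix of mutual inner products. -/
theorem triple_mul_triple (x u v n e₁ e₂ : E3) : triple x u v * triple n e₁ e₂ =
    inner ℝ x n * (inner ℝ u e₁ * inner ℝ v e₂ - inner ℝ u e₂ * inner ℝ v e₁) -
    inner ℝ x e₁ * (inner ℝ u n * inner ℝ v e₂ - inner ℝ u e₂ * inner ℝ v n) +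
    inner ℝ x e₂ * (inner ℝ u n * inner ℝ v e₁ - inner ℝ u e₁ * inner ℝ v n) := by
  simp only [inner_eq_coord, triple_eq_coord]; ring

theorem IsFrame.of_triple_pos {n e₁ e₂ : E3} (nn : inner ℝ n n = 1) (one : inner ℝ e₁ e₁ = 1)
    (two : inner ℝ e₂ e₂ = 1) (n1 : inner ℝ n e₁ = 0) (n2 : inner ℝ n e₂ = 0)
    (one_two : inner ℝ e₁ e₂ = 0) (hpos : 0 < triple n e₁ e₂) : IsFrame n e₁ e₂ := by
  refine ⟨nn, one, two, n1, n2, one_two, ?_⟩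
  have h := triple_mul_triple n e₁ e₂ n e₁ e₂
  rw [nn, one, two, n1, n2, one_two, real_inner_comm n e₁, real_inner_comm n e₂,
    real_inner_comm e₁ e₂, n1, n2, one_two] at h
  nlinarith

namespace IsFrame

variable {n e₁ e₂ : E3}

theorem triple_apply (hf : IsFrame n e₁ e₂) (x u v : E3) : triple x u v =
    inner ℝ x n * (inner ℝ u e₁ * inner ℝ v e₂ - inner ℝ u e₂ * inner ℝ v e₁) -
    inner ℝ x e₁ * (inner ℝ u n * inner ℝ v e₂ - inner ℝ u e₂ * inner ℝ v n) +
    inner ℝ x e₂ * (inner ℝ u n * inner ℝ v e₁ - inner ℝ u e₁ * inner ℝ v n) := by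
  rw [← triple_mul_triple, hf.triple_eq, mul_one]

theorem inner_apply (hf : IsFrame n e₁ e₂) (x y : E3) : inner ℝ x y =
    inner ℝ x n * inner ℝ y n + inner ℝ x e₁ * inner ℝ y e₁ + inner ℝ x e₂ * inner ℝ y e₂ := by
  have hM : (Matrix.of fun i j : Fin 3 => ![n, e₁, e₂] i j) *
      (Matrix.of fun i j : Fin 3 => ![n, e₁, e₂] i j).transpose = 1 := by
    have h1 := hf.nn; have h2 := hf.one; have h3 := hf.two
    have h4 := hf.n1; have h5 := hf.n2; have h6 := hf.one_two
    simp only [inner_eq_coord] at h1 h2 h3 h4 h5 h6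
    ext i j
    fin_cases i <;> fin_cases j <;> simp [Matrix.mul_apply, Fin.sum_univ_three] <;> linarith
  -- Orthonormal rows force orthonormal columns, and the column relations are what expands an inner
  -- product in the frame.
  have hM' := mul_eq_one_comm.1 hM
  have e : ∀ i j : Fin 3, n i * n j + e₁ i * e₁ j + e₂ i * e₂ j =
      (1 : Matrix (Fin 3) (Fin 3) ℝ) i j := by
    intro i j
    rw [← hM', Matrix.mul_apply, Fin.sum_univ_three]
    simp
  have e00 := e 0 0; have e11 := e 1 1; have e22 := e 2 2
  have e01 := e 0 1; have e02 := e 0 2; have e12 := e 1 2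
  simp only [Matrix.one_apply_eq] at e00 e11 e22
  rw [Matrix.one_apply_ne (by decide)] at e01 e02 e12
  simp only [inner_eq_coord]
  linear_combination (-x 0 * y 0) * e00 - x 1 * y 1 * e11 - x 2 * y 2 * e22
    - (x 0 * y 1 + x 1 * y 0) * e01 - (x 0 * y 2 + x 2 * y 0) * e02
    - (x 1 * y 2 + x 2 * y 1) * e12

theorem ext_inner (hf : IsFrame n e₁ e₂) {x y : E3} (h0 : inner ℝ x n = inner ℝ y n)
    (h1 : inner ℝ x e₁ = inner ℝ y e₁) (h2 : inner ℝ x e₂ = inner ℝ y e₂) : x = y := by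
  rw [← sub_eq_zero, ← inner_self_eq_zero (𝕜 := ℝ), hf.inner_apply]
  simp [inner_sub_left, h0, h1, h2]

end IsFrame

/-- Every unit vector is the first vector of a positive orthonormal basis, whose second vector may
be chosen orthogonal to a given vector. -/
theorem exists_isFrame (n p : E3) (hn : inner ℝ n n = 1) :
    ∃ e₁ e₂, IsFrame n e₁ e₂ ∧ inner ℝ p e₁ = 0 := by
  -- The span of `n` and `p` is at most a plane, which leaves a unit vector `e` orthogonal to both;
  -- the cross product of `n` and `e` completes the frame.
  have hlt : Module.finrank ℝ (Submodule.span ℝ {n, p} : Submodule ℝ E3) < 3 := by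
    classical
    have h := finrank_span_finset_le_card (R := ℝ) ({n, p} : Finset E3)
    rw [Finset.coe_pair] at h
    exact lt_of_le_of_lt (h.trans Finset.card_le_two) (by norm_num)
  have hne : (Submodule.span ℝ {n, p} : Submodule ℝ E3)ᗮ ≠ ⊥ := by
    intro h
    rw [Submodule.orthogonal_eq_bot_iff] at h
    rw [h, finrank_top, finrank_euclideanSpace_fin] at hlt
    exact lt_irrefl _ hlt
  obtain ⟨v, hv, hv0⟩ := Submodule.exists_mem_ne_zero_of_ne_bot hne
  rw [Submodule.mem_orthogonal] at hv
  have hnv := hv n (Submodule.subset_span (by simp))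
  have hpv := hv p (Submodule.subset_span (by simp))
  have hvv : ‖v‖ ≠ 0 := norm_ne_zero_iff.2 hv0
  set e : E3 := ‖v‖⁻¹ • v with he
  have hne : inner ℝ n e = 0 := by rw [he, inner_smul_right, hnv, mul_zero]
  have hee : inner ℝ e e = 1 := by
    rw [he, inner_smul_left, inner_smul_right, real_inner_self_eq_norm_sq]
    simp; field_simp
  refine ⟨e, !₂[n 1 * e 2 - n 2 * e 1, n 2 * e 0 - n 0 * e 2, n 0 * e 1 - n 1 * e 0],
    ⟨hn, hee, ?_, hne, ?_, ?_, ?_⟩, by rw [he, inner_smul_right, hpv, mul_zero]⟩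
  all_goals
    simp only [inner_eq_coord] at hn hee hne
    simp only [inner_eq_coord, triple_eq_coord, Matrix.cons_val_zero,
      Matrix.cons_val_one, Matrix.cons_val]
  · linear_combination hn * (e 0 * e 0 + e 1 * e 1 + e 2 * e 2) + hee
      - (n 0 * e 0 + n 1 * e 1 + n 2 * e 2) * hne
  · ring
  · ring
  · linear_combination hn * (e 0 * e 0 + e 1 * e 1 + e 2 * e 2) + hee
      - (n 0 * e 0 + n 1 * e 1 + n 2 * e 2) * hne

/-! ### The angle around the line through two points of the sphere -/

/-- The coordinates of `x - p` with respect to `(e₁, e₂)`, as a complex number. -/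
noncomputable def frameCoord (p e₁ e₂ x : E3) : ℂ := ⟨inner ℝ (x - p) e₁, inner ℝ (x - p) e₂⟩

/-- A frame-free expression for the position of `x` around the line through `p` and `q`,
relative to the position of `x₀`. -/
noncomputable def relPos (p q x₀ x : E3) : ℂ :=
  ⟨inner ℝ (p - q) (p - q) * inner ℝ (x₀ - p) (x - p) -
      inner ℝ (x₀ - p) (p - q) * inner ℝ (x - p) (p - q),
    ‖p - q‖ * triple (p - q) (x₀ - p) (x - p)⟩

/-- `(e₁, e₂)` is an orthonormal frame of the orthogonal complement of `p - q`, positive with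
respect to the direction `p - q`. -/
structure IsAxisFrame (p q e₁ e₂ : E3) : Prop where
  norm_one : ‖e₁‖ = 1
  norm_two : ‖e₂‖ = 1
  inner_eq : inner ℝ e₁ e₂ = 0
  inner_one : inner ℝ (p - q) e₁ = 0
  inner_two : inner ℝ (p - q) e₂ = 0
  triple_pos : 0 < triple (p - q) e₁ e₂

theorem triple_smul_left (c : ℝ) (x u v : E3) : triple (c • x) u v = c * triple x u v := by
  simp [triple_eq_coord]; ring

theorem IsAxisFrame.isFrame {p q e₁ e₂ : E3} (h : IsAxisFrame p q e₁ e₂) (hpq : p ≠ q) :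
    IsFrame (‖p - q‖⁻¹ • (p - q)) e₁ e₂ := by
  have hd : 0 < ‖p - q‖ := norm_pos_iff.2 (sub_ne_zero.2 hpq)
  refine IsFrame.of_triple_pos ?_ ?_ ?_ ?_ ?_ h.inner_eq ?_
  · rw [inner_smul_left, inner_smul_right, real_inner_self_eq_norm_sq]
    simp; field_simp
  · rw [real_inner_self_eq_norm_sq, h.norm_one, one_pow]
  · rw [real_inner_self_eq_norm_sq, h.norm_two, one_pow]
  · rw [inner_smul_left, h.inner_one, mul_zero]
  · rw [inner_smul_left, h.inner_two, mul_zero]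
  · rw [triple_smul_left]
    exact mul_pos (inv_pos.2 hd) h.triple_pos

theorem exists_isAxisFrame {p q : E3} (hpq : p ≠ q) : ∃ e₁ e₂, IsAxisFrame p q e₁ e₂ := by
  have hd : 0 < ‖p - q‖ := norm_pos_iff.2 (sub_ne_zero.2 hpq)
  obtain ⟨e₁, e₂, hf, -⟩ := exists_isFrame (‖p - q‖⁻¹ • (p - q)) 0 (by
    rw [inner_smul_left, inner_smul_right, real_inner_self_eq_norm_sq]
    simp; field_simp)
  have hpos := hf.triple_eq
  have h1 := hf.n1
  have h2 := hf.n2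
  rw [inner_smul_left] at h1 h2
  have hne : (starRingEnd ℝ) ‖p - q‖⁻¹ ≠ 0 := by simpa using sub_ne_zero.2 hpq
  refine ⟨e₁, e₂, ?_, ?_, hf.one_two, (mul_eq_zero.1 h1).resolve_left hne,
    (mul_eq_zero.1 h2).resolve_left hne, ?_⟩
  · have := hf.one
    rw [real_inner_self_eq_norm_sq] at this
    exact (pow_eq_one_iff_of_nonneg (norm_nonneg _) two_ne_zero).1 this
  · have := hf.two
    rw [real_inner_self_eq_norm_sq] at this
    exact (pow_eq_one_iff_of_nonneg (norm_nonneg _) two_ne_zero).1 this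
  · rw [triple_smul_left] at hpos
    by_contra hneg
    have := mul_nonpos_of_nonneg_of_nonpos (inv_pos.2 hd).le (not_lt.1 hneg)
    linarith

/-- In every axis frame `relPos` is the coordinate of `x` times a constant, so it measures the same
change of the argument. Unlike a frame, it needs no choice and varies continuously with `p` and `q`,
which is what isotopies require. -/
theorem relPos_eq {p q e₁ e₂ : E3} (h : IsAxisFrame p q e₁ e₂) (hpq : p ≠ q) (x₀ x : E3) :
    relPos p q x₀ x = ((‖p - q‖ ^ 2 : ℝ) * (starRingEnd ℂ) (frameCoord p e₁ e₂ x₀)) *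
      frameCoord p e₁ e₂ x := by
  have hd : ‖p - q‖ ≠ 0 := norm_ne_zero_iff.2 (sub_ne_zero.2 hpq)
  have hf := h.isFrame hpq
  have e1 := hf.inner_apply (x₀ - p) (x - p)
  have e2 := hf.triple_apply (p - q) (x₀ - p) (x - p)
  simp only [inner_smul_right, h.inner_one, h.inner_two, zero_mul, sub_zero, add_zero,
    real_inner_self_eq_norm_sq] at e1 e2
  apply Complex.ext
  · simp only [relPos, frameCoord, e1, real_inner_self_eq_norm_sq, Complex.mul_re, Complex.mul_im,
      Complex.ofReal_re, Complex.ofReal_im, Complex.conj_re, Complex.conj_im]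
    field_simp
    ring
  · simp only [relPos, frameCoord, e2, Complex.mul_re, Complex.mul_im,
      Complex.ofReal_re, Complex.ofReal_im, Complex.conj_re, Complex.conj_im]
    field_simp
    ring

/-- A point with vanishing coordinates lies on the line through `p` and `q`, and this line meets the
sphere only at those two points. -/
theorem frameCoord_ne_zero {p q e₁ e₂ x : E3} (h : IsAxisFrame p q e₁ e₂) (hpq : p ≠ q)
    (hp : p ∈ S2) (hq : q ∈ S2) (hx : x ∈ S2) (hxp : x ≠ p) (hxq : x ≠ q) :
    frameCoord p e₁ e₂ x ≠ 0 := by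
  intro h0
  have h1 : inner ℝ (x - p) e₁ = 0 := congrArg Complex.re h0
  have h2 : inner ℝ (x - p) e₂ = 0 := congrArg Complex.im h0
  have hf := h.isFrame hpq
  have hd : 0 < ‖p - q‖ := norm_pos_iff.2 (sub_ne_zero.2 hpq)
  set n := ‖p - q‖⁻¹ • (p - q) with hn
  set r := ‖p - q‖ with hr
  have hdn : p - q = r • n := by rw [hn, smul_smul, mul_inv_cancel₀ hd.ne', one_smul]
  have hxn : x - p = (inner ℝ (x - p) n : ℝ) • n := by
    refine hf.ext_inner ?_ ?_ ?_
    · rw [inner_smul_left, hf.nn]; simp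
    · rw [inner_smul_left, hf.n1, h1, mul_zero]
    · rw [inner_smul_left, hf.n2, h2, mul_zero]
  set c : ℝ := inner ℝ (x - p) n with hc
  have hx' : x = p + c • n := by rw [← hxn]; abel
  have hq' : q = p - r • n := by rw [← hdn]; abel
  have i1 := inner_self_of_mem_S2 hx
  have i2 := inner_self_of_mem_S2 hq
  have i3 := inner_self_of_mem_S2 hp
  rw [hx'] at i1
  rw [hq'] at i2
  simp only [inner_add_left, inner_add_right, inner_sub_left, inner_sub_right, inner_smul_left,
    inner_smul_right, hf.nn, real_inner_comm p n, i3, conj_trivial] at i1 i2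
  have hc0 : c ≠ 0 := by
    intro hc0; apply hxp; rw [hx', hc0, zero_smul, add_zero]
  have hcr : c ≠ -r := by
    intro hcr; apply hxq; rw [hx', hq', hcr, neg_smul, sub_eq_add_neg]
  have j1 : c * (c + 2 * inner ℝ p n) = 0 := by linear_combination i1
  have j2 : r * (r - 2 * inner ℝ p n) = 0 := by linear_combination i2
  have k1 := (mul_eq_zero.1 j1).resolve_left hc0
  have k2 := (mul_eq_zero.1 j2).resolve_left hd.ne'
  exact hcr (by linarith)

theorem relPos_ne_zero {p q x₀ x : E3} (hpq : p ≠ q) (hp : p ∈ S2) (hq : q ∈ S2)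
    (hx₀ : x₀ ∈ S2) (hx₀p : x₀ ≠ p) (hx₀q : x₀ ≠ q) (hx : x ∈ S2) (hxp : x ≠ p) (hxq : x ≠ q) :
    relPos p q x₀ x ≠ 0 := by
  obtain ⟨e₁, e₂, h⟩ := exists_isAxisFrame hpq
  rw [relPos_eq h hpq]
  have hd : ‖p - q‖ ≠ 0 := norm_ne_zero_iff.2 (sub_ne_zero.2 hpq)
  refine mul_ne_zero (mul_ne_zero (by exact_mod_cast pow_ne_zero 2 hd) ?_)
    (frameCoord_ne_zero h hpq hp hq hx hxp hxq)
  exact (map_ne_zero _).2 (frameCoord_ne_zero h hpq hp hq hx₀ hx₀p hx₀q)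

theorem Continuous.triple {X : Type*} [TopologicalSpace X] {f g h : X → E3} (hf : Continuous f)
    (hg : Continuous g) (hh : Continuous h) : Continuous fun x => triple (f x) (g x) (h x) := by
  simp only [triple_eq_coord]; fun_prop

theorem continuous_relPos :
    Continuous fun y : (E3 × E3) × (E3 × E3) => relPos y.1.1 y.1.2 y.2.1 y.2.2 := by
  have h : ∀ y : (E3 × E3) × (E3 × E3), relPos y.1.1 y.1.2 y.2.1 y.2.2 =
      ((inner ℝ (y.1.1 - y.1.2) (y.1.1 - y.1.2) * inner ℝ (y.2.1 - y.1.1) (y.2.2 - y.1.1) -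
        inner ℝ (y.2.1 - y.1.1) (y.1.1 - y.1.2) *
          inner ℝ (y.2.2 - y.1.1) (y.1.1 - y.1.2) : ℝ) : ℂ) +
      ((‖y.1.1 - y.1.2‖ * triple (y.1.1 - y.1.2) (y.2.1 - y.1.1) (y.2.2 - y.1.1) : ℝ) : ℂ) *
        Complex.I := fun y => Complex.mk_eq_add_mul_I _ _
  simp only [h]
  have ht : Continuous fun y : (E3 × E3) × (E3 × E3) =>
      triple (y.1.1 - y.1.2) (y.2.1 - y.1.1) (y.2.2 - y.1.1) :=
    Continuous.triple (by fun_prop) (by fun_prop) (by fun_prop)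
  have hi : ∀ {f g : (E3 × E3) × (E3 × E3) → E3}, Continuous f → Continuous g →
      Continuous fun y => inner ℝ (f y) (g y) := fun hf hg => hf.inner hg
  have c1 : Continuous fun y : (E3 × E3) × (E3 × E3) => y.1.1 - y.1.2 := by fun_prop
  have c2 : Continuous fun y : (E3 × E3) × (E3 × E3) => y.2.1 - y.1.1 := by fun_prop
  have c3 : Continuous fun y : (E3 × E3) × (E3 × E3) => y.2.2 - y.1.1 := by fun_prop
  exact (Complex.continuous_ofReal.comp
    (((hi c1 c1).mul (hi c2 c3)).sub ((hi c2 c1).mul (hi c3 c1)))).add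
    ((Complex.continuous_ofReal.comp (c1.norm.mul ht)).mul continuous_const)

theorem continuous_frameCoord (p e₁ e₂ : E3) : Continuous (frameCoord p e₁ e₂) := by
  have h : frameCoord p e₁ e₂ = fun x => ((inner ℝ (x - p) e₁ : ℝ) : ℂ) +
      ((inner ℝ (x - p) e₂ : ℝ) : ℂ) * Complex.I := funext fun x => Complex.mk_eq_add_mul_I _ _
  rw [h]
  fun_prop

theorem hasArgChange_relPos_iff {p q e₁ e₂ x₀ : E3} (h : IsAxisFrame p q e₁ e₂) (hpq : p ≠ q)
    (hp : p ∈ S2) (hq : q ∈ S2) (hx₀ : x₀ ∈ S2) (hx₀p : x₀ ≠ p) (hx₀q : x₀ ≠ q)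
    (l : ℝ → E3) (s t δ : ℝ) :
    HasArgChange (fun τ => relPos p q x₀ (l τ)) s t δ ↔
      HasArgChange (fun τ => frameCoord p e₁ e₂ (l τ)) s t δ := by
  set k : ℂ := (‖p - q‖ ^ 2 : ℝ) * (starRingEnd ℂ) (frameCoord p e₁ e₂ x₀) with hk
  have hk0 : k ≠ 0 := by
    have hd : ‖p - q‖ ≠ 0 := norm_ne_zero_iff.2 (sub_ne_zero.2 hpq)
    refine mul_ne_zero (by exact_mod_cast pow_ne_zero 2 hd) ?_
    exact (map_ne_zero _).2 (frameCoord_ne_zero h hpq hp hq hx₀ hx₀p hx₀q)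
  have e : ∀ x, relPos p q x₀ x = k * frameCoord p e₁ e₂ x := relPos_eq h hpq x₀
  constructor
  · intro hr
    refine (hr.const_mul (inv_ne_zero hk0)).congr fun τ _ => ?_
    rw [e, inv_mul_cancel_left₀ hk0]
  · intro hr
    exact (hr.const_mul hk0).congr fun τ _ => e _

theorem isWindingNumber_iff_exists {p q : E3} {l : ℝ → E3} {s t : ℝ}
    (hl : ContinuousOn l (Set.Icc s t)) (n : ℤ) :
    IsWindingNumber p q l s t n ↔ ∃ e₁ e₂, IsAxisFrame p q e₁ e₂ ∧
      HasArgChange (fun τ => frameCoord p e₁ e₂ (l τ)) s t (2 * Real.pi * n) := by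
  constructor
  · rintro ⟨e₁, e₂, h1, h2, h3, h4, h5, h6, θ, hθ, hr, hθn⟩
    refine ⟨e₁, e₂, ⟨h1, h2, h3, h4, h5, h6⟩, ?_⟩
    have hpolar : ∀ τ ∈ Set.Icc s t, frameCoord p e₁ e₂ (l τ) ≠ 0 ∧ frameCoord p e₁ e₂ (l τ) =
        ‖frameCoord p e₁ e₂ (l τ)‖ * Complex.exp (θ τ * Complex.I) := by
      intro τ hτ
      obtain ⟨r, hr0, hr1, hr2⟩ := hr τ hτ
      have : frameCoord p e₁ e₂ (l τ) = r * Complex.exp (θ τ * Complex.I) := by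
        apply Complex.ext
        · simp [frameCoord, hr1, Complex.exp_ofReal_mul_I_re]
        · simp [frameCoord, hr2, Complex.exp_ofReal_mul_I_im]
      rw [this]
      refine ⟨mul_ne_zero (by exact_mod_cast hr0.ne') (Complex.exp_ne_zero _), ?_⟩
      rw [norm_mul, Complex.norm_exp_ofReal_mul_I, mul_one, Complex.norm_real,
        Real.norm_of_nonneg hr0.le]
    refine ⟨fun τ => (Real.log ‖frameCoord p e₁ e₂ (l τ)‖ : ℂ) + θ τ * Complex.I, ?_, ?_, ?_⟩
    · refine ContinuousOn.add ?_ ?_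
      · refine Complex.continuous_ofReal.comp_continuousOn (ContinuousOn.log ?_ ?_)
        · exact ((continuous_frameCoord p e₁ e₂).comp_continuousOn hl).norm
        · exact fun τ hτ => norm_ne_zero_iff.2 (hpolar τ hτ).1
      · exact (Complex.continuous_ofReal.comp_continuousOn hθ).mul continuousOn_const
    · intro τ hτ
      rw [Complex.exp_add, ← Complex.ofReal_exp, Real.exp_log (norm_pos_iff.2 (hpolar τ hτ).1)]
      exact (hpolar τ hτ).2.symm
    · simpa using hθn
  · rintro ⟨e₁, e₂, ⟨h1, h2, h3, h4, h5, h6⟩, L, hL, hLg, hLn⟩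
    refine ⟨e₁, e₂, h1, h2, h3, h4, h5, h6, fun τ => (L τ).im,
      Complex.continuous_im.comp_continuousOn hL, ?_, by simpa using hLn⟩
    intro τ hτ
    refine ⟨Real.exp (L τ).re, Real.exp_pos _, ?_, ?_⟩
    · rw [← Complex.exp_re, hLg τ hτ]; rfl
    · rw [← Complex.exp_im, hLg τ hτ]; rfl

theorem isWindingNumber_iff_relPos {p q x₀ : E3} (hpq : p ≠ q) (hp : p ∈ S2) (hq : q ∈ S2)
    (hx₀ : x₀ ∈ S2) (hx₀p : x₀ ≠ p) (hx₀q : x₀ ≠ q) {l : ℝ → E3} {s t : ℝ}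
    (hl : ContinuousOn l (Set.Icc s t)) (n : ℤ) :
    IsWindingNumber p q l s t n ↔
      HasArgChange (fun τ => relPos p q x₀ (l τ)) s t (2 * Real.pi * n) := by
  rw [isWindingNumber_iff_exists hl]
  constructor
  · rintro ⟨e₁, e₂, h, hc⟩
    exact (hasArgChange_relPos_iff h hpq hp hq hx₀ hx₀p hx₀q l s t _).2 hc
  · intro hc
    obtain ⟨e₁, e₂, h⟩ := exists_isAxisFrame hpq
    exact ⟨e₁, e₂, h, (hasArgChange_relPos_iff h hpq hp hq hx₀ hx₀p hx₀q l s t _).1 hc⟩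

/-! ### Elementary properties of knotoid diagrams -/

theorem triple_sq_of_orthogonal {x u v : E3} (hx : x ∈ S2) (hu : inner ℝ x u = 0)
    (hv : inner ℝ x v = 0) :
    triple x u v ^ 2 = inner ℝ u u * inner ℝ v v - inner ℝ u v * inner ℝ u v := by
  have h := triple_mul_triple x u v x u v
  rw [inner_self_of_mem_S2 hx, hu, hv, real_inner_comm u v] at h
  rw [sq, h]; ring

/-- Two tangent vectors of the sphere are linearly independent exactly when their triple product
with the normal does not vanish. -/
theorem triple_ne_zero_iff {x u v : E3} (hx : x ∈ S2) (hu : inner ℝ x u = 0)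
    (hv : inner ℝ x v = 0) : triple x u v ≠ 0 ↔ LinearIndependent ℝ ![u, v] := by
  constructor
  · intro h
    rw [LinearIndependent.pair_iff]
    intro a b hab
    have h1 : a * triple x u v = triple x (a • u + b • v) v := by
      simp [triple_eq_coord]; ring
    have h2 : b * triple x u v = triple x u (a • u + b • v) := by
      simp [triple_eq_coord]; ring
    rw [hab] at h1 h2
    have h3 : triple x 0 v = 0 := by simp [triple_eq_coord]
    have h4 : triple x u 0 = 0 := by simp [triple_eq_coord]
    rw [h3] at h1
    rw [h4] at h2
    exact ⟨(mul_eq_zero.1 h1).resolve_right h, (mul_eq_zero.1 h2).resolve_right h⟩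
  · intro hli h
    have hG := triple_sq_of_orthogonal hx hu hv
    rw [h] at hG
    rw [LinearIndependent.pair_iff] at hli
    -- The squared length of this vector is `inner u u` times the Gram determinant, which vanishes
    -- here.
    have hw : (inner ℝ u u : ℝ) • v - (inner ℝ u v : ℝ) • u = 0 := by
      rw [← inner_self_eq_zero (𝕜 := ℝ)]
      simp only [inner_sub_left, inner_sub_right, inner_smul_left, inner_smul_right,
        conj_trivial, real_inner_comm u v]
      linear_combination (-inner ℝ u u) * hG
    have h1 := hli (-(inner ℝ u v : ℝ)) (inner ℝ u u : ℝ) (by rw [← hw, neg_smul]; abel)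
    have hu0 : u = 0 := inner_self_eq_zero.1 h1.2
    have h2 := hli 1 0 (by rw [hu0]; simp)
    exact one_ne_zero h2.1

/-- The velocity of a curve on the sphere is orthogonal to its position. -/
theorem inner_deriv_eq_zero {g : ℝ → E3} {τ : ℝ} {u : E3} (hg : HasDerivAt g u τ)
    (hS : ∀ᶠ x in nhds τ, g x ∈ S2) : inner ℝ (g τ) u = 0 := by
  have h1 := hg.inner ℝ hg
  have h2 : HasDerivAt (fun x => (inner ℝ (g x) (g x) : ℝ)) 0 τ := by
    refine (hasDerivAt_const τ (1 : ℝ)).congr_of_eventuallyEq ?_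
    filter_upwards [hS] with x hx
    exact inner_self_of_mem_S2 hx
  have h3 := h1.unique h2
  rw [real_inner_comm] at h3
  rw [real_inner_comm]
  linarith

namespace KnotoidDiagram

variable (K : KnotoidDiagram)

theorem mem_S2 {t : ℝ} (ht : t ∈ Set.Ioo (0 : ℝ) 1) : K.γ t ∈ S2 :=
  K.mem_sphere t (Set.Ioo_subset_Icc_self ht)

theorem tail_mem : K.γ 0 ∈ S2 := K.mem_sphere 0 (by simp)

theorem head_mem : K.γ 1 ∈ S2 := K.mem_sphere 1 (by simp)

theorem tail_ne_head : K.γ 0 ≠ K.γ 1 := fun h =>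
  lt_irrefl _ (K.interior_double 0 (by simp) 1 (by simp) zero_ne_one h).1

theorem ne_tail {t : ℝ} (ht : t ∈ Set.Ioo (0 : ℝ) 1) : K.γ t ≠ K.γ 0 := fun h =>
  lt_irrefl _ (K.interior_double 0 (by simp) t (Set.Ioo_subset_Icc_self ht) ht.1.ne h.symm).1

theorem ne_head {t : ℝ} (ht : t ∈ Set.Ioo (0 : ℝ) 1) : K.γ t ≠ K.γ 1 := fun h =>
  lt_irrefl _ (K.interior_double 1 (by simp) t (Set.Ioo_subset_Icc_self ht) ht.2.ne' h.symm).2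

theorem hasDerivAt (t : ℝ) : HasDerivAt K.γ (deriv K.γ t) t :=
  (K.smooth.differentiable (by simp) t).hasDerivAt

theorem inner_deriv {t : ℝ} (ht : t ∈ Set.Ioo (0 : ℝ) 1) : inner ℝ (K.γ t) (deriv K.γ t) = 0 :=
  inner_deriv_eq_zero (K.hasDerivAt t) (by
    filter_upwards [isOpen_Ioo.mem_nhds ht] with x hx using K.mem_S2 hx)

variable {K}

theorem IsDouble.symm {s t : ℝ} (h : K.IsDouble s t) : K.IsDouble t s :=
  ⟨h.2.1, h.1, h.2.2.1.symm, h.2.2.2.symm⟩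

theorem IsDouble.mem_Ioo {s t : ℝ} (h : K.IsDouble s t) : s ∈ Set.Ioo (0 : ℝ) 1 :=
  K.interior_double s h.1 t h.2.1 h.2.2.1 h.2.2.2

theorem mem_crossings_iff {c : ℝ × ℝ} : c ∈ K.finite_double.toFinset ↔
    K.IsDouble c.1 c.2 ∧ c.1 < c.2 := by
  simp only [Set.Finite.mem_toFinset, Set.mem_ofPred_eq, IsDouble]
  constructor
  · rintro ⟨h1, h2, h3, h4⟩; exact ⟨⟨h1, h2, h3.ne, h4⟩, h3⟩
  · rintro ⟨⟨h1, h2, _, h4⟩, h3⟩; exact ⟨h1, h2, h3, h4⟩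

theorem Icc_subset_Ioo {s t : ℝ} (hs : s ∈ Set.Ioo (0 : ℝ) 1) (ht : t ∈ Set.Ioo (0 : ℝ) 1) :
    Set.Icc s t ⊆ Set.Ioo 0 1 := fun _ hx => ⟨hs.1.trans_le hx.1, hx.2.trans_lt ht.2⟩

theorem hasIndex_iff_relPos {c : ℝ × ℝ} {x₀ : E3} (hx₀ : x₀ ∈ S2) (h0 : x₀ ≠ K.γ 0)
    (h1 : x₀ ≠ K.γ 1) (n : ℤ) : K.HasIndex c n ↔
    HasArgChange (fun τ => relPos (K.γ 0) (K.γ 1) x₀ (K.γ τ)) c.1 c.2 (2 * Real.pi * n) :=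
  isWindingNumber_iff_relPos K.tail_ne_head K.tail_mem K.head_mem hx₀ h0 h1
    K.smooth.continuous.continuousOn n

theorem HasIndex.unique {c : ℝ × ℝ} (hc : c.1 ≤ c.2) {m n : ℤ} (hm : K.HasIndex c m)
    (hn : K.HasIndex c n) : m = n := by
  have hh : (1 / 2 : ℝ) ∈ Set.Ioo (0 : ℝ) 1 := by constructor <;> norm_num
  rw [hasIndex_iff_relPos (K.mem_S2 hh) (K.ne_tail hh) (K.ne_head hh)] at hm hn
  have := hm.unique hc hn
  have hpi : (2 * Real.pi) ≠ 0 := by positivity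
  exact_mod_cast mul_left_cancel₀ hpi this

end KnotoidDiagram

/-! ### Stereographic projection -/

/-- The stereographic projection from `q`, in the coordinates given by `f₁`, `f₂`. -/
noncomputable def stereo (q f₁ f₂ x : E3) : ℂ :=
  ⟨inner ℝ x f₁ / (1 - inner ℝ x q), inner ℝ x f₂ / (1 - inner ℝ x q)⟩

/-- The derivative of the stereographic projection from `q` at `x`, in the direction `u`. -/
noncomputable def stereoDeriv (q f₁ f₂ x u : E3) : ℂ :=
  ⟨(inner ℝ u f₁ * (1 - inner ℝ x q) + inner ℝ x f₁ * inner ℝ u q) / (1 - inner ℝ x q) ^ 2,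
    (inner ℝ u f₂ * (1 - inner ℝ x q) + inner ℝ x f₂ * inner ℝ u q) / (1 - inner ℝ x q) ^ 2⟩

theorem one_sub_inner_pos {x q : E3} (hx : x ∈ S2) (hq : q ∈ S2) (hxq : x ≠ q) :
    0 < 1 - inner ℝ x q := by
  have h : 0 < inner ℝ (x - q) (x - q) := real_inner_self_pos.2 (sub_ne_zero.2 hxq)
  simp only [inner_sub_left, inner_sub_right, inner_self_of_mem_S2 hx, inner_self_of_mem_S2 hq,
    real_inner_comm x q] at h
  linarith

theorem hasDerivAt_stereo {q f₁ f₂ : E3} {g : ℝ → E3} {u : E3} {τ : ℝ} (hg : HasDerivAt g u τ)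
    (hne : 1 - inner ℝ (g τ) q ≠ 0) :
    HasDerivAt (fun t => stereo q f₁ f₂ (g t)) (stereoDeriv q f₁ f₂ (g τ) u) τ := by
  have hi : ∀ f : E3, HasDerivAt (fun t => (inner ℝ (g t) f : ℝ)) (inner ℝ u f) τ := fun f => by
    simpa using hg.inner ℝ (hasDerivAt_const τ f)
  have hd : ∀ f : E3, HasDerivAt (fun t => (inner ℝ (g t) f / (1 - inner ℝ (g t) q) : ℝ))
      ((inner ℝ u f * (1 - inner ℝ (g τ) q) + inner ℝ (g τ) f * inner ℝ u q) /
        (1 - inner ℝ (g τ) q) ^ 2) τ := fun f => by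
    refine ((hi f).div ((hi q).const_sub 1) hne).congr_deriv ?_
    ring
  have e : (fun t => stereo q f₁ f₂ (g t)) = fun t =>
      ((inner ℝ (g t) f₁ / (1 - inner ℝ (g t) q) : ℝ) : ℂ) +
      ((inner ℝ (g t) f₂ / (1 - inner ℝ (g t) q) : ℝ) : ℂ) * Complex.I :=
    funext fun t => Complex.mk_eq_add_mul_I _ _
  rw [e, stereoDeriv, Complex.mk_eq_add_mul_I]
  exact (hd f₁).ofReal_comp.add ((hd f₂).ofReal_comp.mul_const _)

theorem continuousOn_stereo {q f₁ f₂ : E3} {g : ℝ → E3} {s : Set ℝ} (hg : ContinuousOn g s)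
    (hne : ∀ τ ∈ s, 1 - inner ℝ (g τ) q ≠ 0) :
    ContinuousOn (fun t => stereo q f₁ f₂ (g t)) s := by
  have hi : ∀ f : E3, ContinuousOn (fun t => (inner ℝ (g t) f : ℝ)) s := fun f =>
    hg.inner continuousOn_const
  have e : (fun t => stereo q f₁ f₂ (g t)) = fun t =>
      ((inner ℝ (g t) f₁ / (1 - inner ℝ (g t) q) : ℝ) : ℂ) +
      ((inner ℝ (g t) f₂ / (1 - inner ℝ (g t) q) : ℝ) : ℂ) * Complex.I :=
    funext fun t => Complex.mk_eq_add_mul_I _ _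
  rw [e]
  have hd : ∀ f : E3, ContinuousOn
      (fun t => ((inner ℝ (g t) f / (1 - inner ℝ (g t) q) : ℝ) : ℂ)) s := fun f =>
    Complex.continuous_ofReal.comp_continuousOn
      ((hi f).div (continuousOn_const.sub (hi q)) hne)
  exact (hd f₁).add ((hd f₂).mul continuousOn_const)

namespace IsFrame

variable {q f₁ f₂ x y : E3}

/-- Height and modulus determine each other; this gives injectivity and shows that points near `q`
go to infinity. The frame is taken in the order `q`, `f₂`, `f₁` so that `(f₁, f₂)` is a positive
basis at the antipode of `q`, seen from outside. -/
theorem normSq_stereo (hf : IsFrame q f₂ f₁) (hx : x ∈ S2) (hne : 1 - inner ℝ x q ≠ 0) :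
    Complex.normSq (stereo q f₁ f₂ x) * (1 - inner ℝ x q) = 1 + inner ℝ x q := by
  have h := hf.inner_apply x x
  rw [inner_self_of_mem_S2 hx] at h
  rw [stereo, Complex.normSq_mk]
  field_simp
  linear_combination -h

theorem stereo_injOn (hf : IsFrame q f₂ f₁) (hx : x ∈ S2) (hy : y ∈ S2) (hxq : x ≠ q) (hyq : y ≠ q)
    (h : stereo q f₁ f₂ x = stereo q f₁ f₂ y) : x = y := by
  have hq : q ∈ S2 := by
    rw [S2, mem_sphere_zero_iff_norm, ← pow_eq_one_iff_of_nonneg (norm_nonneg _) two_ne_zero,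
      ← real_inner_self_eq_norm_sq, hf.nn]
  have px := one_sub_inner_pos hx hq hxq
  have py := one_sub_inner_pos hy hq hyq
  have nx := hf.normSq_stereo hx px.ne'
  have ny := hf.normSq_stereo hy py.ne'
  rw [h] at nx
  have h0 : inner ℝ x q = inner ℝ y q := by
    have hn := Complex.normSq_nonneg (stereo q f₁ f₂ y)
    have : (inner ℝ x q - inner ℝ y q) * (Complex.normSq (stereo q f₁ f₂ y) + 1) = 0 := by
      linear_combination ny - nx
    rcases mul_eq_zero.1 this with h' | h' <;> linarith
  have h1 := congrArg Complex.re h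
  have h2 := congrArg Complex.im h
  simp only [stereo] at h1 h2
  rw [h0, div_left_inj' py.ne'] at h1 h2
  exact hf.ext_inner h0 h2 h1

/-- Stereographic projection is conformal and reverses the orientation given by the frame. -/
theorem im_conj_stereoDeriv_mul {u v : E3} (hf : IsFrame q f₂ f₁) (hx : x ∈ S2)
    (hne : 1 - inner ℝ x q ≠ 0) (hu : inner ℝ x u = 0) (hv : inner ℝ x v = 0) :
    ((starRingEnd ℂ) (stereoDeriv q f₁ f₂ x u) * stereoDeriv q f₁ f₂ x v).im =
      triple x u v / (1 - inner ℝ x q) ^ 2 := by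
  have h := hf.inner_apply x x
  rw [inner_self_of_mem_S2 hx] at h
  rw [hf.inner_apply] at hu hv
  rw [hf.triple_apply]
  simp only [stereoDeriv, Complex.mul_im, Complex.conj_re, Complex.conj_im]
  rw [eq_div_iff (pow_ne_zero 2 hne)]
  generalize (inner ℝ x q : ℝ) = x0 at *
  generalize (inner ℝ x f₁ : ℝ) = x1 at *
  generalize (inner ℝ x f₂ : ℝ) = x2 at *
  generalize (inner ℝ u q : ℝ) = u0 at *
  generalize (inner ℝ u f₁ : ℝ) = u1 at *
  generalize (inner ℝ u f₂ : ℝ) = u2 at *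
  generalize (inner ℝ v q : ℝ) = v0 at *
  generalize (inner ℝ v f₁ : ℝ) = v1 at *
  generalize (inner ℝ v f₂ : ℝ) = v2 at *
  field_simp
  linear_combination (1 - x0) * ((u1 * v2 - u2 * v1) * h + (x1 * v2 - x2 * v1) * hu +
    (x2 * u1 - x1 * u2) * hv)

end IsFrame

theorem IsFrame.mem_S2 {n e₁ e₂ : E3} (hf : IsFrame n e₁ e₂) : n ∈ S2 := by
  rw [S2, mem_sphere_zero_iff_norm, ← pow_eq_one_iff_of_nonneg (norm_nonneg _) two_ne_zero,
    ← real_inner_self_eq_norm_sq, hf.nn]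

/-- In a suitable frame, the angle around the line through `p` and `q` is close to the angle
around the image of `p` under the stereographic projection from `q`. -/
theorem exists_isAxisFrame_stereo {p q : E3} (hp : p ∈ S2) (hq : q ∈ S2) (hpq : p ≠ q) :
    ∃ f₁ f₂ e₁ e₂, IsFrame q f₂ f₁ ∧ IsAxisFrame p q e₁ e₂ ∧
      ∀ x ∈ S2, x ≠ p → x ≠ q → 0 < ((stereo q f₁ f₂ x - stereo q f₁ f₂ p) *
        (starRingEnd ℂ) (frameCoord p e₁ e₂ x)).re := by
  obtain ⟨f₂, f₁, hf, hpf⟩ := exists_isFrame q p (inner_self_of_mem_S2 hq)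
  have hd : 0 < ‖p - q‖ := norm_pos_iff.2 (sub_ne_zero.2 hpq)
  have hc := one_sub_inner_pos hp hq hpq
  have hpp := hf.inner_apply p p
  rw [inner_self_of_mem_S2 hp, hpf] at hpp
  set c : ℝ := inner ℝ p q with hcdef
  set s : ℝ := inner ℝ p f₁ with hsdef
  have hqf1 := hf.n2
  have hqf2 := hf.n1
  have hdd : ‖p - q‖ ^ 2 = 2 * (1 - c) := by
    rw [← real_inner_self_eq_norm_sq]
    simp only [inner_sub_left, inner_sub_right, inner_self_of_mem_S2 hp, inner_self_of_mem_S2 hq,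
      real_inner_comm p q, ← hcdef]
    ring
  have hf1q : inner ℝ f₁ q = 0 := by rw [real_inner_comm]; exact hqf1
  have hf2q : inner ℝ f₂ q = 0 := by rw [real_inner_comm]; exact hqf2
  have hf12 : inner ℝ f₁ f₂ = 0 := by rw [real_inner_comm]; exact hf.one_two
  -- As `p` is orthogonal to `f₂`, it lies in the plane of `q` and `f₁`; `g` is the vector of that
  -- plane orthogonal to `p - q` and of the same length.
  set g : E3 := (1 - c) • f₁ + s • q with hg
  have hgf2 : inner ℝ g f₂ = 0 := by
    rw [hg, inner_add_left, inner_smul_left, inner_smul_left, hf12, hqf2]; simp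
  have hgg : inner ℝ g g = ‖p - q‖ ^ 2 := by
    rw [hdd]
    simp only [hg, inner_add_left, inner_add_right, inner_smul_left, inner_smul_right, hf.two,
      hf.nn, hf1q, hqf1, conj_trivial]
    linear_combination -hpp
  have hdg : inner ℝ (p - q) g = 0 := by
    simp only [hg, inner_sub_left, inner_add_right, inner_smul_right, hf.nn, hqf1, ← hcdef,
      ← hsdef]
    ring
  have hax : IsAxisFrame p q (‖p - q‖⁻¹ • g) f₂ := by
    refine ⟨?_, ?_, ?_, ?_, ?_, ?_⟩
    · have hgn : ‖g‖ = ‖p - q‖ := by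
        rw [real_inner_self_eq_norm_sq] at hgg
        exact (pow_left_inj₀ (norm_nonneg _) (norm_nonneg _) two_ne_zero).1 hgg
      rw [norm_smul, norm_inv, norm_norm, hgn, inv_mul_cancel₀ hd.ne']
    · have := hf.one
      rw [real_inner_self_eq_norm_sq] at this
      exact (pow_eq_one_iff_of_nonneg (norm_nonneg _) two_ne_zero).1 this
    · rw [inner_smul_left, hgf2, mul_zero]
    · rw [inner_smul_right, hdg, mul_zero]
    · rw [inner_sub_left, hpf, hqf2, sub_zero]
    · have e1 : triple (p - q) (‖p - q‖⁻¹ • g) f₂ = ‖p - q‖⁻¹ * triple (p - q) g f₂ := by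
        simp [triple_eq_coord]; ring
      rw [e1]
      refine mul_pos (inv_pos.2 hd) ?_
      rw [hf.triple_apply, hgf2, hf.one]
      simp only [hg, inner_sub_left, inner_add_left, inner_smul_left, hf.two, hf.nn, hf1q, hqf1,
        hqf2, hpf, hf2q, conj_trivial, ← hcdef, ← hsdef, hf.one_two]
      nlinarith [sq_nonneg s, mul_pos hc hc]
  refine ⟨f₁, f₂, ‖p - q‖⁻¹ • g, f₂, hf, hax, ?_⟩
  intro x hx hxp hxq
  have h0 := frameCoord_ne_zero hax hpq hp hq hx hxp hxq
  have hxc := one_sub_inner_pos hx hq hxq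
  set a : ℝ := inner ℝ (x - p) (‖p - q‖⁻¹ • g) with ha
  set b : ℝ := inner ℝ (x - p) f₂ with hb
  -- In this frame the real and imaginary parts of the projected difference are positive multiples
  -- of the two frame coordinates, so the real part of the product is a positive combination of
  -- squares.
  have h1 : (stereo q f₁ f₂ x - stereo q f₁ f₂ p).re =
      ‖p - q‖ / ((1 - inner ℝ x q) * (1 - c)) * a := by
    rw [ha, inner_smul_right]
    simp only [stereo, Complex.sub_re, hg, inner_sub_left, inner_add_right, inner_smul_right,
      ← hcdef, ← hsdef]
    field_simp
    ring
  have h2 : (stereo q f₁ f₂ x - stereo q f₁ f₂ p).im = 1 / (1 - inner ℝ x q) * b := by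
    simp only [stereo, Complex.sub_im, hb, inner_sub_left, hpf]
    field_simp
    ring
  have h3 : ((stereo q f₁ f₂ x - stereo q f₁ f₂ p) *
      (starRingEnd ℂ) (frameCoord p (‖p - q‖⁻¹ • g) f₂ x)).re =
      ‖p - q‖ / ((1 - inner ℝ x q) * (1 - c)) * a ^ 2 + 1 / (1 - inner ℝ x q) * b ^ 2 := by
    rw [Complex.mul_re, h1, h2, Complex.conj_re, Complex.conj_im]
    simp only [frameCoord, ← ha, ← hb]
    ring
  rw [h3]
  have k1 : 0 < ‖p - q‖ / ((1 - inner ℝ x q) * (1 - c)) := div_pos hd (mul_pos hxc hc)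
  have k2 : 0 < 1 / (1 - inner ℝ x q : ℝ) := one_div_pos.2 hxc
  by_cases ha0 : a = 0
  · have hb0 : b ≠ 0 := by
      intro hb0
      apply h0
      rw [frameCoord, ← ha, ← hb, ha0, hb0]; rfl
    have := mul_pos k2 (pow_pos (abs_pos.2 hb0) 2)
    rw [sq_abs] at this
    rw [ha0]; simpa using this
  · have h4 := mul_pos k1 (pow_pos (abs_pos.2 ha0) 2)
    rw [sq_abs] at h4
    have h5 := mul_nonneg k2.le (sq_nonneg b)
    linarith

theorem div_mem_slitPlane {z w : ℂ} (h : 0 < (z * (starRingEnd ℂ) w).re) :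
    z / w ∈ Complex.slitPlane := by
  have hw : w ≠ 0 := by rintro rfl; simp at h
  refine Or.inl ?_
  rw [div_eq_mul_inv, Complex.inv_def, ← mul_assoc, Complex.re_mul_ofReal]
  exact mul_pos h (inv_pos.2 (Complex.normSq_pos.2 hw))

/-! ### The index of a crossing as an intersection number with a shortcut. -/

namespace Shortcut

variable {K : KnotoidDiagram} (S : Shortcut K)

theorem hasDerivAt (σ : ℝ) : HasDerivAt S.a (deriv S.a σ) σ :=
  (S.smooth.differentiable (by simp) σ).hasDerivAt

theorem inner_deriv {σ : ℝ} (hσ : σ ∈ Set.Ioo (0 : ℝ) 1) : inner ℝ (S.a σ) (deriv S.a σ) = 0 :=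
  inner_deriv_eq_zero (S.hasDerivAt σ) (by
    filter_upwards [isOpen_Ioo.mem_nhds hσ] with x hx
      using S.mem_sphere x (Set.Ioo_subset_Icc_self hx))

/-- The shortcut is embedded, so `σ` is the only parameter that the definition of `sign` can find;
transversality excludes the value zero. -/
theorem sign_eq {σ τ : ℝ} (hσ : σ ∈ Set.Ioo (0 : ℝ) 1) (hτ : τ ∈ Set.Ioo (0 : ℝ) 1)
    (h : S.a σ = K.γ τ) : (S.sign τ : ℤ) =
      (SignType.sign (triple (K.γ τ) (deriv S.a σ) (deriv K.γ τ)) : ℤ) := by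
  have hne : triple (K.γ τ) (deriv S.a σ) (deriv K.γ τ) ≠ 0 :=
    (triple_ne_zero_iff (K.mem_S2 hτ) (by rw [← h]; exact S.inner_deriv hσ)
      (K.inner_deriv hτ)).2 (S.transverse σ hσ τ hτ h)
  unfold sign
  split_ifs with hex
  · obtain ⟨σ', hσ', h', hpos⟩ := hex
    have : σ' = σ := S.injOn (Set.Ioo_subset_Icc_self hσ') (Set.Ioo_subset_Icc_self hσ)
      (h'.trans h.symm)
    subst this
    rw [sign_pos hpos]; simp
  · have hneg : triple (K.γ τ) (deriv S.a σ) (deriv K.γ τ) < 0 := by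
      rcases lt_or_gt_of_ne hne with h1 | h1
      · exact h1
      · exact absurd ⟨σ, hσ, h, h1⟩ hex
    rw [sign_neg hneg]; simp

open Classical in
/-- The index of a crossing is the sum of the signs of the intersections with a shortcut along the
loop at the crossing. -/
theorem index_eq_sum {c : ℝ × ℝ} (hc : K.IsDouble c.1 c.2) (hlt : c.1 < c.2) {n : ℤ}
    (hn : K.HasIndex c n) :
    n = ∑ τ ∈ S.finite_inter.toFinset with τ ∈ Set.Ioo c.1 c.2, (S.sign τ : ℤ) := by
  have hpq := K.tail_ne_head
  have hq := K.head_mem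
  have hp := K.tail_mem
  have hsub := KnotoidDiagram.Icc_subset_Ioo hc.mem_Ioo hc.symm.mem_Ioo
  obtain ⟨f₁, f₂, e₁, e₂, hf, hax, hpos⟩ := exists_isAxisFrame_stereo hp hq hpq
  set F := {τ ∈ S.finite_inter.toFinset | τ ∈ Set.Ioo c.1 c.2} with hF
  have hFm : ∀ τ, τ ∈ F ↔ (∃ σ ∈ Set.Ioo (0 : ℝ) 1, S.a σ = K.γ τ) ∧ τ ∈ Set.Ioo c.1 c.2 := by
    intro τ
    rw [hF, Finset.mem_filter, Set.Finite.mem_toFinset, Set.mem_ofPred_eq]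
    refine ⟨fun h => ⟨h.1.2, h.2⟩, fun h => ⟨⟨hsub (Set.Ioo_subset_Icc_self h.2), h.1⟩, h.2⟩⟩
  have hex : ∀ τ, ∃ σ, τ ∈ F → σ ∈ Set.Ioo (0 : ℝ) 1 ∧ S.a σ = K.γ τ := by
    intro τ
    by_cases h : τ ∈ F
    · obtain ⟨⟨σ, h1, h2⟩, -⟩ := (hFm τ).1 h
      exact ⟨σ, fun _ => ⟨h1, h2⟩⟩
    · exact ⟨0, fun h' => absurd h' h⟩
  choose sg hsg using hex
  have hneγ : ∀ τ ∈ Set.Icc c.1 c.2, 1 - inner ℝ (K.γ τ) (K.γ 1) ≠ 0 := fun τ hτ =>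
    (one_sub_inner_pos (K.mem_S2 (hsub hτ)) hq (K.ne_head (hsub hτ))).ne'
  have ha_ne : ∀ σ ∈ Set.Ico (0 : ℝ) 1, S.a σ ≠ K.γ 1 := by
    intro σ hσ h
    rw [← S.head] at h
    exact hσ.2.ne (S.injOn (Set.Ico_subset_Icc_self hσ) (by simp) h)
  have hnea : ∀ σ ∈ Set.Ico (0 : ℝ) 1, 1 - inner ℝ (S.a σ) (K.γ 1) ≠ 0 := fun σ hσ =>
    (one_sub_inner_pos (S.mem_sphere σ (Set.Ico_subset_Icc_self hσ)) hq (ha_ne σ hσ)).ne'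
  set ζ : ℝ → ℂ := fun τ => stereo (K.γ 1) f₁ f₂ (K.γ τ) with hζ
  set α : ℝ → ℂ := fun σ => stereo (K.γ 1) f₁ f₂ (S.a σ) with hα
  have hζc : ContinuousOn ζ (Set.Icc c.1 c.2) :=
    continuousOn_stereo K.smooth.continuous.continuousOn hneγ
  have hclosed : ζ c.1 = ζ c.2 := by simp only [hζ, hc.2.2.2]
  -- a parameter of the shortcut close to the head
  obtain ⟨M, hM⟩ : ∃ M : ℝ, ∀ τ ∈ Set.Icc c.1 c.2, Complex.normSq (ζ τ) ≤ M := by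
    obtain ⟨M, hM⟩ := isCompact_Icc.exists_bound_of_continuousOn
      (Complex.continuous_normSq.comp_continuousOn hζc)
    exact ⟨M, fun τ hτ => (le_abs_self _).trans (hM τ hτ)⟩
  obtain ⟨σ₁, hσ₁0, hσ₁1, hσ₁F, hσ₁M⟩ : ∃ σ₁ : ℝ, 0 < σ₁ ∧ σ₁ < 1 ∧ (∀ τ ∈ F, sg τ < σ₁) ∧
      M < Complex.normSq (α σ₁) := by
    -- The shortcut is cut off at `σ₁`, past its intersections with the loop and farther out in the
    -- plane than the whole loop. By `IsFrame.normSq_stereo`, lying farther out than `M` means that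
    -- this function is positive, and at the head its value is 2.
    have hcont : Continuous fun σ => (1 + inner ℝ (S.a σ) (K.γ 1)) -
        M * (1 - inner ℝ (S.a σ) (K.γ 1)) := by
      have := S.smooth.continuous
      fun_prop
    have h1 : ∀ᶠ σ in nhdsWithin (1 : ℝ) (Set.Iio 1), 0 < (1 + inner ℝ (S.a σ) (K.γ 1)) -
        M * (1 - inner ℝ (S.a σ) (K.γ 1)) := by
      refine (hcont.tendsto 1).mono_left nhdsWithin_le_nhds |>.eventually (lt_mem_nhds ?_)
      rw [S.head, inner_self_of_mem_S2 hq]; norm_num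
    have h2 : ∀ᶠ σ in nhdsWithin (1 : ℝ) (Set.Iio 1), ∀ τ ∈ F, sg τ < σ := by
      rw [Filter.eventually_all_finset]
      intro τ hτ
      exact mem_nhdsWithin_of_mem_nhds (lt_mem_nhds (hsg τ hτ).1.2)
    have h3 : ∀ᶠ σ in nhdsWithin (1 : ℝ) (Set.Iio 1), 0 < σ :=
      mem_nhdsWithin_of_mem_nhds (lt_mem_nhds one_pos)
    obtain ⟨σ, k1, k2, k3, k4⟩ := (h1.and (h2.and (h3.and self_mem_nhdsWithin))).exists
    refine ⟨σ, k3, k4, k2, ?_⟩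
    have hpos' := one_sub_inner_pos (S.mem_sphere σ ⟨k3.le, le_of_lt k4⟩) hq (ha_ne σ ⟨k3.le, k4⟩)
    have hn := hf.normSq_stereo (S.mem_sphere σ ⟨k3.le, le_of_lt k4⟩) hpos'.ne'
    by_contra hle
    have := mul_le_mul_of_nonneg_right (not_lt.1 hle) hpos'.le
    simp only [hα] at this
    linarith
  have hsub₁ : ∀ σ ∈ Set.Icc 0 σ₁, σ ∈ Set.Ico (0 : ℝ) 1 := fun σ hσ =>
    ⟨hσ.1, hσ.2.trans_lt hσ₁1⟩
  have hαc : ContinuousOn α (Set.Icc 0 σ₁) :=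
    continuousOn_stereo S.smooth.continuous.continuousOn fun σ hσ => hnea σ (hsub₁ σ hσ)
  -- the intersections
  set Z : Finset (ℝ × ℝ) := F.image fun τ => (sg τ, τ) with hZ
  have hZm : ∀ z ∈ Z, z.2 ∈ F ∧ z.1 = sg z.2 := by
    intro z hz
    obtain ⟨τ, hτ, rfl⟩ := Finset.mem_image.1 hz
    exact ⟨hτ, rfl⟩
  have hZa : ∀ z ∈ Z, S.a z.1 = K.γ z.2 := fun z hz => by
    rw [(hZm z hz).2]; exact (hsg _ (hZm z hz).1).2
  have hZ1 : ∀ z ∈ Z, z.1 ∈ Set.Ioo (0 : ℝ) 1 := fun z hz => by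
    rw [(hZm z hz).2]; exact (hsg _ (hZm z hz).1).1
  have hZ2 : ∀ z ∈ Z, z.2 ∈ Set.Ioo c.1 c.2 := fun z hz => ((hFm _).1 (hZm z hz).1).2
  have hZ2' : ∀ z ∈ Z, z.2 ∈ Set.Ioo (0 : ℝ) 1 := fun z hz =>
    hsub (Set.Ioo_subset_Icc_self (hZ2 z hz))
  set A : ℝ × ℝ → ℂ := fun z => stereoDeriv (K.γ 1) f₁ f₂ (S.a z.1) (deriv S.a z.1) with hA
  set B : ℝ × ℝ → ℂ := fun z => stereoDeriv (K.γ 1) f₁ f₂ (K.γ z.2) (deriv K.γ z.2) with hB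
  have hABim : ∀ z ∈ Z, ((starRingEnd ℂ) (A z) * B z).im =
      triple (K.γ z.2) (deriv S.a z.1) (deriv K.γ z.2) /
        (1 - inner ℝ (K.γ z.2) (K.γ 1)) ^ 2 := by
    intro z hz
    simp only [hA, hB, hZa z hz]
    exact hf.im_conj_stereoDeriv_mul (K.mem_S2 (hZ2' z hz))
      (hneγ _ (Set.Ioo_subset_Icc_self (hZ2 z hz)))
      (by rw [← hZa z hz]; exact S.inner_deriv (hZ1 z hz)) (K.inner_deriv (hZ2' z hz))
  have hsq : ∀ z ∈ Z, (0 : ℝ) < ((1 - inner ℝ (K.γ z.2) (K.γ 1)) ^ 2)⁻¹ := fun z hz =>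
    inv_pos.2 (pow_pos (one_sub_inner_pos (K.mem_S2 (hZ2' z hz)) hq (K.ne_head (hZ2' z hz))) 2)
  have hsignZ : ∀ z ∈ Z, (SignType.sign ((starRingEnd ℂ) (A z) * B z).im : ℤ) = S.sign z.2 := by
    intro z hz
    rw [S.sign_eq (hZ1 z hz) (hZ2' z hz) (hZa z hz), hABim z hz, div_eq_mul_inv, sign_mul,
      sign_pos (hsq z hz), mul_one]
  -- the two winding numbers
  have hγc : ContinuousOn (fun τ => frameCoord (K.γ 0) e₁ e₂ (K.γ τ)) (Set.Icc c.1 c.2) :=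
    ((continuous_frameCoord _ _ _).comp K.smooth.continuous).continuousOn
  have hm := hc.mem_Ioo
  rw [KnotoidDiagram.hasIndex_iff_relPos (K.mem_S2 hm) (K.ne_tail hm) (K.ne_head hm),
    hasArgChange_relPos_iff hax hpq hp hq (K.mem_S2 hm) (K.ne_tail hm) (K.ne_head hm)] at hn
  -- Around the image of the tail the projected loop never points opposite to the frame coordinate
  -- of the loop, so both have the same change of the argument.
  have hstart : HasArgChange (fun τ => ζ τ - α 0) c.1 c.2 (2 * Real.pi * n) := by
    refine hn.of_div_mem_slitPlane hγc (hζc.sub continuousOn_const) (fun τ hτ => ?_)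
      (by simp only [hc.2.2.2]) (by simp only [hclosed])
    refine div_mem_slitPlane ?_
    simp only [hα, S.tail]
    exact hpos _ (K.mem_S2 (hsub hτ)) (K.ne_tail (hsub hτ)) (K.ne_head (hsub hτ))
  have hend : HasArgChange (fun τ => ζ τ - α σ₁) c.1 c.2 0 := by
    have hM0 : 0 ≤ M := (Complex.normSq_nonneg _).trans (hM c.1 (Set.left_mem_Icc.2 hlt.le))
    have hα0 : α σ₁ ≠ 0 := Complex.normSq_pos.1 (hM0.trans_lt hσ₁M)
    refine (HasArgChange.const (neg_ne_zero.2 hα0)).of_div_mem_slitPlane continuousOn_const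
      (hζc.sub continuousOn_const) (fun τ hτ => ?_) rfl (by simp only [hclosed])
    have h1 : ‖ζ τ‖ < ‖α σ₁‖ := by
      have := (hM τ hτ).trans_lt hσ₁M
      rw [Complex.normSq_eq_norm_sq, Complex.normSq_eq_norm_sq] at this
      exact lt_of_pow_lt_pow_left₀ 2 (norm_nonneg _) this
    have h2 : ‖ζ τ / α σ₁‖ < 1 := by
      rw [norm_div, div_lt_one (norm_pos_iff.2 hα0)]; exact h1
    -- Seen from a point farther out than the whole loop, the directions to the loop stay in a
    -- half-plane, so the loop does not wind around it.
    have h3 : (ζ τ - α σ₁) / -α σ₁ = 1 - ζ τ / α σ₁ := by field_simp; ring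
    rw [h3]
    refine Or.inl ?_
    rw [Complex.sub_re, Complex.one_re, sub_pos]
    exact (Complex.re_le_norm _).trans_lt h2
  have key := argChange_sub_eq_sum hσ₁0.le hlt.le hαc hζc hclosed Z
    (fun z hz => ⟨⟨(hZ1 z hz).1, by rw [(hZm z hz).2]; exact hσ₁F _ (hZm z hz).1⟩, hZ2 z hz⟩)
    (fun σ hσ τ hτ h => ?_) A B (fun z hz => by simp only [hα, hζ, hZa z hz])
    (fun z hz => hasDerivAt_stereo (S.hasDerivAt _) (hnea _ (Set.Ioo_subset_Ico_self (hZ1 z hz))))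
    (fun z hz => hasDerivAt_stereo (K.hasDerivAt _)
      (hneγ _ (Set.Ioo_subset_Icc_self (hZ2 z hz))))
    (fun z hz => ?_) hstart hend
  · rw [sub_zero, Finset.sum_congr rfl hsignZ] at key
    have hpi : (2 * Real.pi) ≠ 0 := by positivity
    have h1 := mul_left_cancel₀ hpi key
    rw [hZ, Finset.sum_image (fun x _ y _ h => congrArg Prod.snd h)] at h1
    exact_mod_cast h1
  · have h1 : S.a σ = K.γ τ := hf.stereo_injOn
      (S.mem_sphere σ (Set.Ico_subset_Icc_self (hsub₁ σ hσ))) (K.mem_S2 (hsub hτ))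
      (ha_ne σ (hsub₁ σ hσ)) (K.ne_head (hsub hτ)) h
    have hσ0 : σ ≠ 0 := by
      rintro rfl
      rw [S.tail] at h1
      exact K.ne_tail (hsub hτ) h1.symm
    have hσI : σ ∈ Set.Ioo (0 : ℝ) 1 :=
      ⟨lt_of_le_of_ne hσ.1 (Ne.symm hσ0), (hsub₁ σ hσ).2⟩
    -- The loop begins and ends at a crossing, which the shortcut avoids; hence every zero lies in
    -- the interior of the rectangle.
    have hτ1 : τ ≠ c.1 := by
      rintro rfl
      exact S.avoids_crossings σ (Set.Ioo_subset_Icc_self hσI) _ _ hc h1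
    have hτ2 : τ ≠ c.2 := by
      rintro rfl
      exact S.avoids_crossings σ (Set.Ioo_subset_Icc_self hσI) _ _ hc.symm h1
    have hτF : τ ∈ F := (hFm τ).2 ⟨⟨σ, hσI, h1⟩, lt_of_le_of_ne hτ.1 (Ne.symm hτ1),
      lt_of_le_of_ne hτ.2 hτ2⟩
    have : σ = sg τ := S.injOn (Set.Ioo_subset_Icc_self hσI)
      (Set.Ioo_subset_Icc_self (hsg τ hτF).1) (h1.trans (hsg τ hτF).2.symm)
    rw [this]
    exact Finset.mem_image_of_mem _ hτF
  · rw [hABim z hz, div_eq_mul_inv]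
    refine mul_ne_zero ?_ (hsq z hz).ne'
    exact (triple_ne_zero_iff (K.mem_S2 (hZ2' z hz))
      (by rw [← hZa z hz]; exact S.inner_deriv (hZ1 z hz)) (K.inner_deriv (hZ2' z hz))).2
      (S.transverse _ (hZ1 z hz) _ (hZ2' z hz) (hZa z hz))

end Shortcut

/-! ### Blocks of the sign sequence -/

/-- The sorted list is the concatenation of the elements up to `s`, those strictly between `s` and
`t`, and those from `t` on. -/
theorem Finset.exists_infix_sort (F : Finset ℝ) (s t : ℝ) :
    ∃ B : List ℝ, B <:+: F.sort (· ≤ ·) ∧ B.Nodup ∧ ∀ x, x ∈ B ↔ x ∈ F ∧ x ∈ Set.Ioo s t := by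
  classical
  rcases le_or_gt t s with hts | hst
  · refine ⟨[], List.nil_infix, List.nodup_nil, fun x => ?_⟩
    simp [Set.Ioo_eq_empty (not_lt.2 hts)]
  refine ⟨{x ∈ F | x ∈ Set.Ioo s t}.sort (· ≤ ·),
    ⟨{x ∈ F | x ≤ s}.sort (· ≤ ·), {x ∈ F | t ≤ x}.sort (· ≤ ·), ?_⟩, Finset.sort_nodup _ _,
    fun x => by simp⟩
  refine List.Perm.eq_of_pairwise' (r := (· ≤ ·)) ?_ (Finset.pairwise_sort _ _) ?_
  · rw [List.pairwise_append, List.pairwise_append]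
    refine ⟨⟨Finset.pairwise_sort _ _, Finset.pairwise_sort _ _, ?_⟩, Finset.pairwise_sort _ _, ?_⟩
    · intro a ha b hb
      simp at ha hb
      linarith
    · intro a ha b hb
      simp at ha hb
      rcases ha with ha | ha <;> linarith
  · rw [List.perm_ext_iff_of_nodup]
    · intro x
      simp only [List.mem_append, Finset.mem_sort, Finset.mem_filter, Set.mem_Ioo]
      constructor
      · tauto
      · intro hx
        rcases le_or_gt x s with h1 | h1
        · tauto
        · rcases lt_or_ge x t with h2 | h2 <;> tauto
    · rw [List.nodup_append, List.nodup_append]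
      refine ⟨⟨Finset.sort_nodup _ _, Finset.sort_nodup _ _, ?_⟩, Finset.sort_nodup _ _, ?_⟩
      · intro a ha b hb
        simp at ha hb
        exact (ha.2.trans_lt hb.2.1).ne
      · intro a ha b hb
        simp at ha hb
        rcases ha with ha | ha
        · exact (ha.2.trans_lt (hst.trans_le hb.2)).ne
        · exact (ha.2.2.trans_le hb.2).ne
    · exact Finset.sort_nodup _ _

open Classical in
theorem Shortcut.exists_block {K : KnotoidDiagram} (S : Shortcut K) (s t : ℝ) :
    ∃ B : List ℤˣ, B <:+: S.signSeq ∧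
      signSum B = ∑ τ ∈ S.finite_inter.toFinset with τ ∈ Set.Ioo s t, (S.sign τ : ℤ) := by
  obtain ⟨L, hL, hnd, hmem⟩ := S.finite_inter.toFinset.exists_infix_sort s t
  refine ⟨L.map S.sign, hL.map _, ?_⟩
  rw [signSum, List.map_map, ← List.sum_toFinset _ hnd]
  refine Finset.sum_congr ?_ fun _ _ => rfl
  ext x
  rw [List.mem_toFinset, hmem, Finset.mem_filter]

/-- The index of a crossing is the sum of a block of the sign sequence of every shortcut. -/
theorem Shortcut.exists_block_of_hasIndex {K : KnotoidDiagram} (S : Shortcut K) {c : ℝ × ℝ}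
    (hc : c ∈ K.finite_double.toFinset) {n : ℤ} (hn : K.HasIndex c n) :
    ∃ B : List ℤˣ, B <:+: S.signSeq ∧ signSum B = n := by
  rw [KnotoidDiagram.mem_crossings_iff] at hc
  rw [S.index_eq_sum hc.1 hc.2 hn]
  exact S.exists_block _ _

/-! ### The coefficients of the index polynomial -/

namespace KnotoidDiagram

variable (K : KnotoidDiagram)

theorem exists_hasIndex_of_writhe_ne_zero {n : ℤ} (h : K.writhe n ≠ 0) :
    ∃ c ∈ K.finite_double.toFinset, K.HasIndex c n := by
  classical
  by_contra hcon
  push Not at hcon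
  apply h
  rw [writhe, Finset.filter_false_of_mem hcon, Finset.sum_empty, mul_zero]

/-- Every index with nonzero writhe is carried by a crossing, and a crossing has at most one index.
Finiteness is needed because `finsum` takes the value 0 on infinite supports. -/
theorem finite_support_writhe : (Function.support K.writhe).Finite := by
  classical
  have hex : ∀ n : ℤ, ∃ c, K.writhe n ≠ 0 → c ∈ K.finite_double.toFinset ∧ K.HasIndex c n := by
    intro n
    by_cases h : K.writhe n = 0
    · exact ⟨0, fun h' => absurd h h'⟩
    · obtain ⟨c, h1, h2⟩ := K.exists_hasIndex_of_writhe_ne_zero h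
      exact ⟨c, fun _ => ⟨h1, h2⟩⟩
  choose c hc using hex
  refine Set.Finite.of_finite_image (f := c)
    (K.finite_double.toFinset.finite_toSet.subset ?_) ?_
  · rintro _ ⟨n, hn, rfl⟩
    exact (hc n hn).1
  · intro m hm n hn h
    have h1 := (hc m hm).2
    rw [h] at h1
    exact h1.unique (mem_crossings_iff.1 (hc n hn).1).2.le (hc n hn).2

/-- The summands `-1` affect only the constant term. -/
theorem coeff_indexPolynomial {n : ℤ} (hn : n ≠ 0) : K.indexPolynomial.coeff n = K.writhe n := by
  classical
  rw [indexPolynomial]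
  simp only [finsum_eq_if]
  rw [finsum_eq_sum_of_support_subset (s := K.finite_support_writhe.toFinset)]
  · have hCT : ∀ (a : ℚ) (m : ℤ), (LaurentPolynomial.C a * LaurentPolynomial.T m).coeff n =
        if m = n then a else 0 := by
      intro a m
      rw [← LaurentPolynomial.single_eq_C_mul_T]
      exact Finsupp.single_apply
    rw [AddMonoidAlgebra.coeff_sum, Finsupp.finsetSum_apply]
    have : ∀ m : ℤ, (if m ≠ 0 then LaurentPolynomial.C (K.writhe m) *
        (LaurentPolynomial.T m - 1) else 0 : ℚ[T;T⁻¹]).coeff n =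
        if m = n then K.writhe n else 0 := by
      intro m
      split_ifs with h1 h2 h2
      · subst h2
        rw [mul_sub, mul_one, AddMonoidAlgebra.coeff_sub, Finsupp.sub_apply, hCT]
        simp [hn]
      · rw [mul_sub, mul_one, AddMonoidAlgebra.coeff_sub, Finsupp.sub_apply, hCT]
        simp [hn, h2]
      · subst h2; exact absurd hn h1
      · simp
    rw [Finset.sum_congr rfl fun m _ => this m, Finset.sum_ite_eq']
    split_ifs with h
    · rfl
    · simpa [eq_comm] using h
  · intro m hm
    rw [Set.Finite.coe_toFinset]
    intro h0
    apply hm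
    simp [h0]

theorem indexPolynomial_congr {K K' : KnotoidDiagram} (h : ∀ n, n ≠ 0 → K.writhe n = K'.writhe n) :
    K.indexPolynomial = K'.indexPolynomial := by
  unfold indexPolynomial
  refine finsum_congr fun n => finsum_congr fun hn => ?_
  rw [h n hn]

end KnotoidDiagram

theorem Shortcut.exists_block_degPlus {K : KnotoidDiagram} (S : Shortcut K) :
    ∃ B : List ℤˣ, B <:+: S.signSeq ∧ signSum B = degPlus K.indexPolynomial := by
  unfold degPlus
  split_ifs with h
  · rcases le_or_gt (K.indexPolynomial.coeff.support.max' h) 0 with h0 | h0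
    · exact ⟨[], List.nil_infix, by simp [signSum, max_eq_right h0]⟩
    · have hmem := Finset.max'_mem _ h
      rw [Finsupp.mem_support_iff, K.coeff_indexPolynomial h0.ne'] at hmem
      obtain ⟨c, hc, hn⟩ := K.exists_hasIndex_of_writhe_ne_zero hmem
      rw [max_eq_left h0.le]
      exact S.exists_block_of_hasIndex hc hn
  · exact ⟨[], List.nil_infix, by simp [signSum]⟩

theorem Shortcut.exists_block_degMinus {K : KnotoidDiagram} (S : Shortcut K) :
    ∃ B : List ℤˣ, B <:+: S.signSeq ∧ signSum B = - degMinus K.indexPolynomial := by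
  unfold degMinus
  split_ifs with h
  · rcases le_or_gt 0 (K.indexPolynomial.coeff.support.min' h) with h0 | h0
    · refine ⟨[], List.nil_infix, ?_⟩
      rw [max_eq_right (by omega)]; simp [signSum]
    · have hmem := Finset.min'_mem _ h
      rw [Finsupp.mem_support_iff, K.coeff_indexPolynomial h0.ne] at hmem
      obtain ⟨c, hc, hn⟩ := K.exists_hasIndex_of_writhe_ne_zero hmem
      rw [max_eq_left (by omega), neg_neg]
      exact S.exists_block_of_hasIndex hc hn
  · exact ⟨[], List.nil_infix, by simp [signSum]⟩

/-! ### Invariance of the writhes: general facts -/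

theorem triple_swap (x u v : E3) : triple x v u = -triple x u v := by
  simp only [triple_eq_coord]; ring

namespace HasArgChange

theorem iff_eq {g : ℝ → ℂ} {s t δ ε : ℝ} (hst : s ≤ t) (h : HasArgChange g s t δ) :
    HasArgChange g s t ε ↔ δ = ε :=
  ⟨fun h' => h.unique hst h', fun e => e ▸ h⟩

end HasArgChange

namespace KnotoidDiagram

variable {K K' : KnotoidDiagram}

open Classical in
theorem crossingSign_eq (s t : ℝ) : K.crossingSign s t = (if K.passesOver s t then 1 else -1) *
    (SignType.sign (triple (K.γ s) (deriv K.γ s) (deriv K.γ t)) : ℤ) := by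
  unfold crossingSign
  split_ifs
  · rw [one_mul]
  · rw [triple_swap, Left.sign_neg, neg_one_mul]
    cases SignType.sign (triple (K.γ s) (deriv K.γ s) (deriv K.γ t)) <;> rfl

theorem crossingSign_congr {s t s' t' : ℝ} (ho : K'.passesOver s' t' ↔ K.passesOver s t)
    (hs : SignType.sign (triple (K'.γ s') (deriv K'.γ s') (deriv K'.γ t')) =
      SignType.sign (triple (K.γ s) (deriv K.γ s) (deriv K.γ t))) :
    K'.crossingSign s' t' = K.crossingSign s t := by
  rw [crossingSign_eq, crossingSign_eq, hs]
  by_cases h : K.passesOver s t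
  · rw [if_pos h, if_pos (ho.2 h)]
  · rw [if_neg h, if_neg fun h' => h (ho.1 h')]

theorem IsDouble.crossingSign_comm {s t : ℝ} (h : K.IsDouble s t) :
    K.crossingSign t s = K.crossingSign s t := by
  have ho := K.passesOver_iff s h.1 t h.2.1 h.2.2.1 h.2.2.2
  unfold crossingSign
  rw [h.2.2.2]
  by_cases h1 : K.passesOver s t
  · rw [if_neg (ho.1 h1), if_pos h1]
  · rw [if_pos (by tauto), if_neg h1]

open Classical in
/-- The contribution of a crossing to the double of the `n`-writhe. -/
noncomputable def writheTerm (K : KnotoidDiagram) (n : ℤ) (c : ℝ × ℝ) : ℤ :=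
  if K.HasIndex c n then K.crossingSign c.1 c.2 else 0

theorem writhe_eq (n : ℤ) :
    K.writhe n = (1 / 2) * ((∑ c ∈ K.finite_double.toFinset, K.writheTerm n c : ℤ) : ℚ) := by
  classical
  rw [writhe, Finset.sum_filter, Int.cast_sum]
  congr 1
  refine Finset.sum_congr rfl fun c _ => ?_
  rw [writheTerm]
  split_ifs <;> simp

theorem writheTerm_congr {n : ℤ} {c c' : ℝ × ℝ} (hi : K.HasIndex c n ↔ K'.HasIndex c' n)
    (hs : K.crossingSign c.1 c.2 = K'.crossingSign c'.1 c'.2) :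
    K.writheTerm n c = K'.writheTerm n c' := by
  unfold writheTerm
  by_cases h : K.HasIndex c n
  · rw [if_pos h, if_pos (hi.1 h), hs]
  · rw [if_neg h, if_neg fun h' => h (hi.2 h')]

/-- It need not be known that `δ` is a multiple of `2π`: by `HasArgChange.iff_eq`, having index `n`
means `δ = 2πn`, so invariance of the index reduces to comparing two real numbers. -/
theorem IsDouble.exists_argChange {s t : ℝ} (h : K.IsDouble s t) (hst : s < t) {x₀ : E3}
    (hx₀ : x₀ ∈ S2) (h0 : x₀ ≠ K.γ 0) (h1 : x₀ ≠ K.γ 1) :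
    ∃ δ, HasArgChange (fun τ => relPos (K.γ 0) (K.γ 1) x₀ (K.γ τ)) s t δ := by
  have hsub := Icc_subset_Ioo h.mem_Ioo h.symm.mem_Ioo
  refine HasArgChange.exists_of_ne_zero hst.le ?_ fun τ hτ => ?_
  · have := K.smooth.continuous
    exact (continuous_relPos.comp (f := fun τ => ((K.γ 0, K.γ 1), (x₀, K.γ τ)))
      (by fun_prop)).continuousOn
  · exact relPos_ne_zero K.tail_ne_head K.tail_mem K.head_mem hx₀ h0 h1 (K.mem_S2 (hsub hτ))
      (K.ne_tail (hsub hτ)) (K.ne_head (hsub hτ))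

/-! ### Changes of parameter -/

/-- An increasing change of parameter matches the crossings bijectively, pulls logarithms back by
composition, and scales velocities by positive factors. -/
theorem Reparametrization.writhe_eq (h : K.Reparametrization K') (n : ℤ) :
    K.writhe n = K'.writhe n := by
  obtain ⟨ψ, hψ, hpos, h0, h1, hγ, ho⟩ := h
  have hmono : StrictMonoOn ψ (Set.Icc 0 1) :=
    strictMonoOn_of_deriv_pos (convex_Icc 0 1) hψ.continuous.continuousOn fun t ht =>
      hpos t (interior_subset ht)
  have hmaps : ∀ t ∈ Set.Icc (0 : ℝ) 1, ψ t ∈ Set.Icc (0 : ℝ) 1 := by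
    intro t ht
    constructor
    · rw [← h0]; exact hmono.monotoneOn (by simp) ht ht.1
    · rw [← h1]; exact hmono.monotoneOn ht (by simp) ht.2
  have hsurj : ∀ t ∈ Set.Icc (0 : ℝ) 1, ∃ s ∈ Set.Icc (0 : ℝ) 1, ψ s = t := by
    have := intermediate_value_Icc (zero_le_one (α := ℝ)) hψ.continuous.continuousOn
    rw [h0, h1] at this
    exact this
  have hdouble : ∀ s t, K'.IsDouble s t → K.IsDouble (ψ s) (ψ t) := by
    rintro s t ⟨hs, ht, hne, he⟩
    exact ⟨hmaps s hs, hmaps t ht, fun h => hne (hmono.injOn hs ht h),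
      by rw [← hγ s hs, ← hγ t ht, he]⟩
  have hderiv : ∀ t ∈ Set.Ioo (0 : ℝ) 1, deriv K'.γ t = deriv ψ t • deriv K.γ (ψ t) := by
    intro t ht
    have h2 : HasDerivAt (fun t => K.γ (ψ t)) (deriv ψ t • deriv K.γ (ψ t)) t :=
      (K.hasDerivAt (ψ t)).scomp t (hψ.differentiable (by simp) t).hasDerivAt
    refine (h2.congr_of_eventuallyEq ?_).deriv
    filter_upwards [isOpen_Ioo.mem_nhds ht] with x hx using hγ x (Set.Ioo_subset_Icc_self hx)
  rw [KnotoidDiagram.writhe_eq, KnotoidDiagram.writhe_eq]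
  congr 2
  symm
  refine Finset.sum_nbij (fun c => (ψ c.1, ψ c.2)) ?_ ?_ ?_ ?_
  · intro c hc
    rw [mem_crossings_iff] at hc ⊢
    exact ⟨hdouble _ _ hc.1, hmono hc.1.1 hc.1.2.1 hc.2⟩
  · intro c hc d hd he
    rw [Finset.mem_coe, mem_crossings_iff] at hc hd
    rw [Prod.mk.injEq] at he
    exact Prod.ext (hmono.injOn hc.1.1 hd.1.1 he.1) (hmono.injOn hc.1.2.1 hd.1.2.1 he.2)
  · intro c hc
    rw [Finset.mem_coe, mem_crossings_iff] at hc
    obtain ⟨s, hs, hs'⟩ := hsurj _ hc.1.1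
    obtain ⟨t, ht, ht'⟩ := hsurj _ hc.1.2.1
    have hlt : s < t := by
      rw [← hmono.lt_iff_lt hs ht, hs', ht']; exact hc.2
    refine ⟨(s, t), ?_, by simp only [hs', ht']⟩
    rw [Finset.mem_coe, mem_crossings_iff]
    refine ⟨⟨hs, ht, hlt.ne, ?_⟩, hlt⟩
    rw [hγ s hs, hγ t ht, hs', ht']; exact hc.1.2.2.2
  · intro c hc
    rw [mem_crossings_iff] at hc
    have hd := hdouble _ _ hc.1
    have hlt := hmono hc.1.1 hc.1.2.1 hc.2
    refine writheTerm_congr ?_ ?_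
    · have hm := hd.mem_Ioo
      have e0 : K'.γ 0 = K.γ 0 := by rw [hγ 0 (by simp), h0]
      have e1 : K'.γ 1 = K.γ 1 := by rw [hγ 1 (by simp), h1]
      have hx := K.mem_S2 hm
      have hx0 := K.ne_tail hm
      have hx1 := K.ne_head hm
      obtain ⟨δ, hδ⟩ := hd.exists_argChange hlt hx hx0 hx1
      have hδ' : HasArgChange (fun τ => relPos (K.γ 0) (K.γ 1) (K.γ (ψ c.1)) (K'.γ τ)) c.1 c.2
          δ := by
        obtain ⟨L, hL, hLe, rfl⟩ := hδ
        have hmaps' : Set.MapsTo ψ (Set.Icc c.1 c.2) (Set.Icc (ψ c.1) (ψ c.2)) := by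
          intro τ hτ
          have hτ' : τ ∈ Set.Icc (0 : ℝ) 1 :=
            ⟨hc.1.1.1.trans hτ.1, hτ.2.trans hc.1.2.1.2⟩
          exact ⟨hmono.monotoneOn hc.1.1 hτ' hτ.1, hmono.monotoneOn hτ' hc.1.2.1 hτ.2⟩
        refine ⟨fun τ => L (ψ τ), hL.comp hψ.continuous.continuousOn hmaps', fun τ hτ => ?_, rfl⟩
        rw [hLe _ (hmaps' hτ)]
        simp only [hγ τ ⟨hc.1.1.1.trans hτ.1, hτ.2.trans hc.1.2.1.2⟩]
      rw [hasIndex_iff_relPos (K := K) hx hx0 hx1, hδ.iff_eq hlt.le,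
        hasIndex_iff_relPos (K := K') hx (by rwa [e0]) (by rwa [e1]), e0, e1, hδ'.iff_eq hc.2.le]
    · refine crossingSign_congr (ho _ _ hc.1) ?_
      have hm1 := hc.1.mem_Ioo
      have hm2 := hc.1.symm.mem_Ioo
      rw [hderiv _ hm1, hderiv _ hm2, hγ _ hc.1.1]
      have e : ∀ (a b : ℝ) (x u v : E3), triple x (a • u) (b • v) = (a * b) * triple x u v := by
        intro a b x u v; simp [triple_eq_coord]; ring
      rw [e, sign_mul, sign_pos (mul_pos (hpos _ hc.1.1) (hpos _ hc.1.2.1)), one_mul]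

/-! ### Planar isotopies -/

theorem sign_eq_of_continuous {f : ℝ → ℝ} (hf : Continuous f)
    (h0 : ∀ t ∈ Set.Icc (0 : ℝ) 1, f t ≠ 0) : SignType.sign (f 0) = SignType.sign (f 1) := by
  have k0 := h0 0 (by simp)
  have k1 := h0 1 (by simp)
  rcases lt_or_gt_of_ne k0 with a | a <;> rcases lt_or_gt_of_ne k1 with b | b
  · rw [sign_neg a, sign_neg b]
  · obtain ⟨t, ht, hft⟩ := intermediate_value_Icc (zero_le_one (α := ℝ)) hf.continuousOn
      ⟨a.le, b.le⟩
    exact absurd hft (h0 t ht)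
  · obtain ⟨t, ht, hft⟩ := intermediate_value_Icc' (zero_le_one (α := ℝ)) hf.continuousOn
      ⟨b.le, a.le⟩
    exact absurd hft (h0 t ht)
  · rw [sign_pos a, sign_pos b]

/-- The velocity at time `s` of the image of a curve under a family of smooth maps. -/
theorem hasDerivAt_family {Φ : ℝ → E3 → E3} (hΦ : ContDiff ℝ ∞ fun p : ℝ × E3 => Φ p.1 p.2)
    {g : ℝ → E3} {s : ℝ} {u : E3} (hg : HasDerivAt g u s) (τ : ℝ) :
    HasDerivAt (fun r => Φ τ (g r)) (fderiv ℝ (fun p : ℝ × E3 => Φ p.1 p.2) (τ, g s) (0, u)) s := by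
  have h := (hΦ.differentiable (by simp) (τ, g s)).hasFDerivAt
  exact h.comp_hasDerivAt (f := fun x => (τ, g x)) s ((hasDerivAt_const s τ).prodMk hg)

/-- During the isotopy the triple product varies continuously and never vanishes, because the two
branches stay transverse; so its sign is constant. -/
theorem PlanarIsotopy.sign_triple {Φ Ψ : ℝ → E3 → E3} (hΦ : IsAmbientIsotopy Φ Ψ)
    (hγ : ∀ t ∈ Set.Icc (0 : ℝ) 1, K'.γ t = Φ 1 (K.γ t)) {s t : ℝ} (hd : K.IsDouble s t) :
    SignType.sign (triple (K'.γ s) (deriv K'.γ s) (deriv K'.γ t)) =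
      SignType.sign (triple (K.γ s) (deriv K.γ s) (deriv K.γ t)) := by
  set w : ℝ → E3 → E3 := fun τ u => fderiv ℝ (fun p : ℝ × E3 => Φ p.1 p.2) (τ, K.γ s) (0, u) with hw
  have hwd : ∀ r, K.γ r = K.γ s → ∀ τ,
      HasDerivAt (fun x => Φ τ (K.γ x)) (w τ (deriv K.γ r)) r := by
    intro r hr τ
    simp only [hw, ← hr]
    exact hasDerivAt_family hΦ.smooth (K.hasDerivAt r) τ
  have hs := hd.mem_Ioo
  have ht := hd.symm.mem_Ioo
  have hts : K.γ t = K.γ s := hd.2.2.2.symm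
  have hw0 : ∀ r ∈ Set.Ioo (0 : ℝ) 1, K.γ r = K.γ s → w 0 (deriv K.γ r) = deriv K.γ r := by
    intro r hr hrs
    refine ((hwd r hrs 0).unique ((K.hasDerivAt r).congr_of_eventuallyEq ?_))
    filter_upwards [isOpen_Ioo.mem_nhds hr] with x hx using hΦ.start _ (K.mem_S2 hx)
  have hw1 : ∀ r ∈ Set.Ioo (0 : ℝ) 1, K.γ r = K.γ s → w 1 (deriv K.γ r) = deriv K'.γ r := by
    intro r hr hrs
    refine ((hwd r hrs 1).unique ((K'.hasDerivAt r).congr_of_eventuallyEq ?_))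
    filter_upwards [isOpen_Ioo.mem_nhds hr] with x hx
    exact (hγ x (Set.Ioo_subset_Icc_self hx)).symm
  have hwc : ∀ u, Continuous fun τ => w τ u := by
    intro u
    have := hΦ.smooth.continuous_fderiv (by simp)
    have h2 : Continuous fun τ : ℝ => fderiv ℝ (fun p : ℝ × E3 => Φ p.1 p.2) (τ, K.γ s) :=
      this.comp (by fun_prop)
    exact h2.clm_apply continuous_const
  have hΦc : Continuous fun τ => Φ τ (K.γ s) :=
    hΦ.smooth.continuous.comp (f := fun τ => (τ, K.γ s)) (by fun_prop)
  have key := sign_eq_of_continuous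
    (f := fun τ => triple (Φ τ (K.γ s)) (w τ (deriv K.γ s)) (w τ (deriv K.γ t)))
    (Continuous.triple hΦc (hwc _) (hwc _)) ?_
  · simp only [hw0 s hs rfl, hw0 t ht hts, hw1 s hs rfl, hw1 t ht hts,
      hΦ.start _ (K.mem_S2 hs)] at key
    rw [hγ s hd.1, key]
  · intro τ hτ
    have htan : ∀ r ∈ Set.Ioo (0 : ℝ) 1, K.γ r = K.γ s →
        inner ℝ (Φ τ (K.γ s)) (w τ (deriv K.γ r)) = 0 := by
      intro r hr hrs
      have := inner_deriv_eq_zero (hwd r hrs τ) (by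
        filter_upwards [isOpen_Ioo.mem_nhds hr] with x hx using hΦ.mapsTo τ hτ (K.mem_S2 hx))
      rwa [hrs] at this
    refine (triple_ne_zero_iff (hΦ.mapsTo τ hτ (K.mem_S2 hs)) (htan s hs rfl) (htan t ht hts)).2 ?_
    -- The derivative of the inverse map takes the transported velocities back to those of `K`,
    -- which are independent.
    set A : E3 →ₗ[ℝ] E3 :=
      ((fderiv ℝ (fun p : ℝ × E3 => Ψ p.1 p.2) (τ, Φ τ (K.γ s))).comp
        (ContinuousLinearMap.inr ℝ ℝ E3)).toLinearMap with hA
    have hAw : ∀ r ∈ Set.Ioo (0 : ℝ) 1, K.γ r = K.γ s → A (w τ (deriv K.γ r)) = deriv K.γ r := by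
      intro r hr hrs
      have h1 := hasDerivAt_family hΦ.smooth_inv (hwd r hrs τ) τ
      have h2 := h1.unique ((K.hasDerivAt r).congr_of_eventuallyEq (by
        filter_upwards [isOpen_Ioo.mem_nhds hr] with x hx
          using hΦ.left_inv τ hτ _ (K.mem_S2 hx)))
      rw [hrs] at h2
      exact h2
    refine LinearIndependent.of_comp A ?_
    convert K.transverse s hd.1 t hd.2.1 hd.2.2.1 hd.2.2.2 using 1
    ext i : 1
    fin_cases i
    · exact hAw s hs rfl
    · exact hAw t ht hts

/-- The isotopy moves the loop, both punctures and the base point together, so `relPos` stays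
defined and nonzero throughout, and homotopy invariance applies. -/
theorem PlanarIsotopy.hasIndex_iff {Φ Ψ : ℝ → E3 → E3} (hΦ : IsAmbientIsotopy Φ Ψ)
    (hγ : ∀ t ∈ Set.Icc (0 : ℝ) 1, K'.γ t = Φ 1 (K.γ t)) {c : ℝ × ℝ} (hd : K.IsDouble c.1 c.2)
    (hd' : K'.IsDouble c.1 c.2) (hlt : c.1 < c.2) (n : ℤ) :
    K.HasIndex c n ↔ K'.HasIndex c n := by
  have hm := hd.mem_Ioo
  have hsub := Icc_subset_Ioo hd.mem_Ioo hd.symm.mem_Ioo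
  obtain ⟨δ, hδ⟩ := hd.exists_argChange hlt (K.mem_S2 hm) (K.ne_tail hm) (K.ne_head hm)
  obtain ⟨δ', hδ'⟩ := hd'.exists_argChange hlt (K'.mem_S2 hm) (K'.ne_tail hm) (K'.ne_head hm)
  rw [hasIndex_iff_relPos (K := K) (K.mem_S2 hm) (K.ne_tail hm) (K.ne_head hm),
    hδ.iff_eq hlt.le,
    hasIndex_iff_relPos (K := K') (K'.mem_S2 hm) (K'.ne_tail hm) (K'.ne_head hm),
    hδ'.iff_eq hlt.le]
  have hinj : ∀ τ ∈ Set.Icc (0 : ℝ) 1, ∀ x ∈ S2, ∀ y ∈ S2, x ≠ y → Φ τ x ≠ Φ τ y := by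
    intro τ hτ x hx y hy hxy h
    apply hxy
    rw [← hΦ.left_inv τ hτ x hx, h, hΦ.left_inv τ hτ y hy]
  have hc1 : c.1 ∈ Set.Icc c.1 c.2 := Set.left_mem_Icc.2 hlt.le
  have e : δ = δ' := by
    refine HasArgChange.homotopy (G := fun y => relPos (Φ y.1 (K.γ 0)) (Φ y.1 (K.γ 1))
      (Φ y.1 (K.γ c.1)) (Φ y.1 (K.γ y.2))) (a := 0) (b := 1) (c := c.1) (d := c.2) zero_le_one
      hlt.le ?_ ?_ ?_ (hδ.congr ?_) (hδ'.congr ?_)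
    · have h1 : ∀ f : ℝ × ℝ → E3, Continuous f → Continuous fun y : ℝ × ℝ => Φ y.1 (f y) :=
        fun f hf => hΦ.smooth.continuous.comp (f := fun y : ℝ × ℝ => (y.1, f y)) (by fun_prop)
      have hγc := K.smooth.continuous
      exact (continuous_relPos.comp (f := fun y : ℝ × ℝ =>
        ((Φ y.1 (K.γ 0), Φ y.1 (K.γ 1)), (Φ y.1 (K.γ c.1), Φ y.1 (K.γ y.2))))
        (((h1 _ continuous_const).prodMk (h1 _ continuous_const)).prodMk
          ((h1 _ continuous_const).prodMk (h1 _ (by fun_prop))))).continuousOn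
    · rintro ⟨τ, r⟩ ⟨hτ, hr⟩
      have hr' := hsub hr
      exact relPos_ne_zero (hinj τ hτ _ K.tail_mem _ K.head_mem K.tail_ne_head)
        (hΦ.mapsTo τ hτ K.tail_mem) (hΦ.mapsTo τ hτ K.head_mem) (hΦ.mapsTo τ hτ (K.mem_S2 hm))
        (hinj τ hτ _ (K.mem_S2 hm) _ K.tail_mem (K.ne_tail hm))
        (hinj τ hτ _ (K.mem_S2 hm) _ K.head_mem (K.ne_head hm))
        (hΦ.mapsTo τ hτ (K.mem_S2 hr'))
        (hinj τ hτ _ (K.mem_S2 hr') _ K.tail_mem (K.ne_tail hr'))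
        (hinj τ hτ _ (K.mem_S2 hr') _ K.head_mem (K.ne_head hr'))
    · intro x _
      simp only [hd.2.2.2]
    · intro r hr
      simp only [hΦ.start _ K.tail_mem, hΦ.start _ K.head_mem, hΦ.start _ (K.mem_S2 hm),
        hΦ.start _ (K.mem_S2 (hsub hr))]
    · intro r hr
      simp only [hγ 0 (by simp), hγ 1 (by simp), hγ _ hd.1,
        hγ r (Set.Ioo_subset_Icc_self (hsub hr))]
  rw [e]

theorem PlanarIsotopy.writhe_eq (h : K.PlanarIsotopy K') (n : ℤ) : K.writhe n = K'.writhe n := by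
  obtain ⟨Φ, Ψ, hΦ, hγ, ho⟩ := h
  have hdouble : ∀ s t, K'.IsDouble s t ↔ K.IsDouble s t := by
    intro s t
    have h1 : (1 : ℝ) ∈ Set.Icc (0 : ℝ) 1 := by simp
    constructor
    · rintro ⟨hs, ht, hne, he⟩
      refine ⟨hs, ht, hne, ?_⟩
      rw [hγ s hs, hγ t ht] at he
      rw [← hΦ.left_inv 1 h1 _ (K.mem_sphere s hs), he, hΦ.left_inv 1 h1 _ (K.mem_sphere t ht)]
    · rintro ⟨hs, ht, hne, he⟩
      exact ⟨hs, ht, hne, by rw [hγ s hs, hγ t ht, he]⟩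
  rw [KnotoidDiagram.writhe_eq, KnotoidDiagram.writhe_eq]
  congr 2
  refine Finset.sum_congr ?_ ?_
  · ext c
    rw [mem_crossings_iff, mem_crossings_iff, hdouble]
  · intro c hc
    rw [mem_crossings_iff] at hc
    have hd := (hdouble _ _).1 hc.1
    refine writheTerm_congr (PlanarIsotopy.hasIndex_iff hΦ hγ hd hc.1 hc.2 n) ?_
    exact (crossingSign_congr (ho _ _ hd) (PlanarIsotopy.sign_triple hΦ hγ hd)).symm

end KnotoidDiagram

/-! ### Invariance under local changes -/

/-- A continuous injection of a compact set into a Hausdorff space is a closed map. This transports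
the logarithm from the parameter disk to its image in the sphere. -/
theorem continuousOn_invFunOn_of_isCompact {X Y : Type*} [TopologicalSpace X] [TopologicalSpace Y]
    [Nonempty X] [T2Space Y] {s : Set X} (hs : IsCompact s) {f : X → Y}
    (hf : ContinuousOn f s) (hinj : Set.InjOn f s) :
    ContinuousOn (Function.invFunOn f s) (f '' s) := by
  rw [continuousOn_iff_isClosed]
  intro t ht
  refine ⟨f '' (s ∩ t), ((hs.inter_right ht).image_of_continuousOn
    (hf.mono Set.inter_subset_left)).isClosed, ?_⟩
  ext y
  constructor
  · rintro ⟨hy, x, hx, rfl⟩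
    rw [Set.mem_preimage, hinj.leftInvOn_invFunOn hx] at hy
    exact ⟨⟨x, ⟨hx, hy⟩, rfl⟩, x, hx, rfl⟩
  · rintro ⟨⟨x, ⟨hx, hxt⟩, rfl⟩, hy⟩
    refine ⟨?_, hy⟩
    rw [Set.mem_preimage, hinj.leftInvOn_invFunOn hx]
    exact hxt

namespace KnotoidDiagram

variable {K K' : KnotoidDiagram} {m : ℕ} {l u : Fin m → ℝ}

namespace MeetsDiskInArcs

variable {f : EuclideanSpace ℝ (Fin 2) → E3}

theorem eq_of_mem (h : K.MeetsDiskInArcs f l u) {i j : Fin m} {t : ℝ}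
    (hi : t ∈ Set.Icc (l i) (u i)) (hj : t ∈ Set.Icc (l j) (u j)) : i = j := by
  by_contra hij
  exact Set.disjoint_left.1 (h.disjoint i j hij) hi hj

theorem Icc_subset (h : K.MeetsDiskInArcs f l u) (i : Fin m) :
    Set.Icc (l i) (u i) ⊆ Set.Ioo 0 1 := fun _ ht =>
  ⟨(h.interval i).1.trans_le ht.1, ht.2.trans_lt (h.interval i).2.2⟩

/-- Disjoint intervals are ordered as wholes, so which strand of a crossing comes first depends only
on the two arcs. -/
theorem lt_iff (h : K.MeetsDiskInArcs f l u) {i j : Fin m} (hij : i ≠ j) {s t : ℝ}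
    (hs : s ∈ Set.Icc (l i) (u i)) (ht : t ∈ Set.Icc (l j) (u j)) : s < t ↔ l i < l j := by
  have aux : ∀ {i j : Fin m}, i ≠ j → l i < l j → u i < l j := by
    intro i j hij hlt
    by_contra hle
    exact hij (h.eq_of_mem ⟨hlt.le, not_lt.1 hle⟩ ⟨le_rfl, (h.interval j).2.1.le⟩)
  constructor
  · intro hst
    by_contra hle
    rcases lt_or_eq_of_le (not_lt.1 hle) with h1 | h1
    · have := aux (Ne.symm hij) h1
      exact absurd hst (not_lt.2 (ht.2.trans (this.le.trans hs.1)))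
    · refine hij (h.eq_of_mem ⟨le_rfl, (h.interval i).2.1.le⟩ ?_)
      rw [← h1]
      exact ⟨le_rfl, (h.interval j).2.1.le⟩
  · intro hlt
    exact hs.2.trans_lt ((aux hij hlt).trans_le ht.1)

/-- If one of the two strands at a double point is in the disk, then so is the other one. -/
theorem mem_arc_iff (h : K.MeetsDiskInArcs f l u) {s t : ℝ} (hd : K.IsDouble s t) :
    (∃ i, s ∈ Set.Icc (l i) (u i)) ↔ ∃ i, t ∈ Set.Icc (l i) (u i) := by
  rw [← h.mem_disk s hd.1, ← h.mem_disk t hd.2.1, hd.2.2.2]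

theorem isDoubleOn_iff (h : K.MeetsDiskInArcs f l u) {s t : ℝ} :
    K.IsDoubleOn l u s t ↔ K.IsDouble s t ∧ ∃ i, s ∈ Set.Icc (l i) (u i) :=
  ⟨fun hd => ⟨hd.1, hd.2.1⟩, fun hd => ⟨hd.1, hd.2, (h.mem_arc_iff hd.1).1 hd.2⟩⟩

end MeetsDiskInArcs

/-- The two diagrams coincide outside the arcs in the disk. -/
theorem eventuallyEq_of_agree (hagree : ∀ t ∈ Set.Icc (0 : ℝ) 1,
    (∀ i, t ∉ Set.Ioo (l i) (u i)) → K.γ t = K'.γ t) {t : ℝ} (ht : t ∈ Set.Ioo (0 : ℝ) 1)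
    (hout : ∀ i, t ∉ Set.Icc (l i) (u i)) : K.γ =ᶠ[nhds t] K'.γ := by
  have h1 : ∀ᶠ x in nhds t, ∀ i, x ∉ Set.Icc (l i) (u i) :=
    Filter.eventually_all.2 fun i => isClosed_Icc.isOpen_compl.mem_nhds (hout i)
  filter_upwards [isOpen_Ioo.mem_nhds ht, h1] with x hx hx'
  exact hagree x (Set.Ioo_subset_Icc_self hx) fun i hi => hx' i (Set.Ioo_subset_Icc_self hi)

/-- Continuous logarithms along two diagrams that agree outside a disk: they agree outside the arcs
in the disk, and on each of these arcs they are given by a logarithm on the disk. -/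
theorem AgreeOutsideDisk.exists_log (h : K.AgreeOutsideDisk K' l u) :
    ∃ (x₀ : E3) (L L' : ℝ → ℂ) (B : E3 → ℂ) (κ : Fin m → ℂ),
      (x₀ ∈ S2 ∧ x₀ ≠ K.γ 0 ∧ x₀ ≠ K.γ 1) ∧
      ContinuousOn L (Set.Ioo 0 1) ∧ ContinuousOn L' (Set.Ioo 0 1) ∧
      (∀ t ∈ Set.Ioo (0 : ℝ) 1, Complex.exp (L t) = relPos (K.γ 0) (K.γ 1) x₀ (K.γ t)) ∧
      (∀ t ∈ Set.Ioo (0 : ℝ) 1, Complex.exp (L' t) = relPos (K.γ 0) (K.γ 1) x₀ (K'.γ t)) ∧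
      (∀ t, (∀ i, t ∉ Set.Icc (l i) (u i)) → L' t = L t) ∧
      (∀ i, ∀ t ∈ Set.Icc (l i) (u i), L t = B (K.γ t) + κ i) ∧
      ∀ i, ∀ t ∈ Set.Icc (l i) (u i), L' t = B (K'.γ t) + κ i := by
  classical
  obtain ⟨f, hf, hK, hK', hagree, -⟩ := h
  have hpq := K.tail_ne_head
  have hp := K.tail_mem
  have hq := K.head_mem
  have hh : (1 / 2 : ℝ) ∈ Set.Ioo (0 : ℝ) 1 := by constructor <;> norm_num
  set x₀ := K.γ (1 / 2) with hx₀def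
  have hx₀ : x₀ ∈ S2 := K.mem_S2 hh
  have hx₀p : x₀ ≠ K.γ 0 := K.ne_tail hh
  have hx₀q : x₀ ≠ K.γ 1 := K.ne_head hh
  set R : E3 → ℂ := relPos (K.γ 0) (K.γ 1) x₀ with hR
  have hRc : Continuous R :=
    continuous_relPos.comp (f := fun x => ((K.γ 0, K.γ 1), (x₀, x))) (by fun_prop)
  have hR0 : ∀ x ∈ S2, x ≠ K.γ 0 → x ≠ K.γ 1 → R x ≠ 0 := fun x hx h0 h1 =>
    relPos_ne_zero hpq hp hq hx₀ hx₀p hx₀q hx h0 h1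
  -- the logarithm on the disk
  set D : Set E3 := f '' Metric.closedBall 0 1 with hD
  have hDp : K.γ 0 ∉ D := by
    rw [hD, hK.mem_disk 0 (by simp)]
    rintro ⟨i, hi⟩
    exact absurd (hK.interval i).1 (not_lt.2 hi.1)
  have hDq : K.γ 1 ∉ D := by
    rw [hD, hK.mem_disk 1 (by simp)]
    rintro ⟨i, hi⟩
    exact absurd (hK.interval i).2.2 (not_lt.2 hi.2)
  have hDR : ∀ x ∈ D, R x ≠ 0 := by
    intro x hx
    refine hR0 x ?_ (fun h => hDp (h ▸ hx)) (fun h => hDq (h ▸ hx))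
    obtain ⟨y, hy, rfl⟩ := hx
    exact hf.mapsTo hy
  -- Both punctures lie outside the disk, so one logarithm on it serves all arcs of both diagrams.
  obtain ⟨M, hM, hMe⟩ := exists_continuousOn_log_closedBall (g := fun y => R (f y))
    (hRc.comp hf.smooth.continuous).continuousOn (fun y hy => hDR _ ⟨y, hy, rfl⟩)
  set B : E3 → ℂ := fun x => M (Function.invFunOn f (Metric.closedBall 0 1) x) with hB
  have hBc : ContinuousOn B D :=
    hM.comp (continuousOn_invFunOn_of_isCompact (isCompact_closedBall _ _)
      hf.smooth.continuous.continuousOn hf.injOn)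
      fun x hx => Function.invFunOn_mem hx
  have hBe : ∀ x ∈ D, Complex.exp (B x) = R x := by
    intro x hx
    rw [hB, hMe _ (Function.invFunOn_mem hx), Function.invFunOn_eq hx]
  have hγc := K.smooth.continuous
  have hγc' := K'.smooth.continuous
  -- the logarithm along the first diagram
  obtain ⟨L, hL, hLe⟩ := exists_continuousOn_log_Ioo (zero_lt_one (α := ℝ))
    (g := fun t => R (K.γ t)) (hRc.comp hγc).continuousOn
    (fun t ht => hR0 _ (K.mem_S2 ht) (K.ne_tail ht) (K.ne_head ht))
  have hmemD : ∀ i, ∀ t ∈ Set.Icc (l i) (u i), K.γ t ∈ D := fun i t ht =>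
    (hK.mem_disk t (Set.Ioo_subset_Icc_self (hK.Icc_subset i ht))).2 ⟨i, ht⟩
  have hmemD' : ∀ i, ∀ t ∈ Set.Icc (l i) (u i), K'.γ t ∈ D := fun i t ht =>
    (hK'.mem_disk t (Set.Ioo_subset_Icc_self (hK.Icc_subset i ht))).2 ⟨i, ht⟩
  set κ : Fin m → ℂ := fun i => L (l i) - B (K.γ (l i)) with hκ
  have hLκ : ∀ i, ∀ t ∈ Set.Icc (l i) (u i), L t = B (K.γ t) + κ i := by
    intro i t ht
    have := log_sub_const isPreconnected_Icc (hL.mono (hK.Icc_subset i))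
      (hBc.comp hγc.continuousOn (hmemD i))
      (fun x hx => by
        rw [hLe x (hK.Icc_subset i hx)]; exact (hBe _ (hmemD i x hx)).symm)
      ht (Set.left_mem_Icc.2 (hK.interval i).2.1.le)
    simp only [Function.comp_apply] at this
    simp only [hκ]
    linear_combination this
  -- the logarithm along the second diagram
  set L' : ℝ → ℂ := fun t => if h : ∃ i, t ∈ Set.Icc (l i) (u i) then B (K'.γ t) + κ h.choose
    else L t with hL'
  have hLκ' : ∀ i, ∀ t ∈ Set.Icc (l i) (u i), L' t = B (K'.γ t) + κ i := by
    intro i t ht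
    have hex : ∃ i, t ∈ Set.Icc (l i) (u i) := ⟨i, ht⟩
    simp only [hL', dif_pos hex]
    rw [hK.eq_of_mem hex.choose_spec ht]
  have hLout : ∀ t, (∀ i, t ∉ Set.Icc (l i) (u i)) → L' t = L t := by
    intro t ht
    have hex : ¬ ∃ i, t ∈ Set.Icc (l i) (u i) := fun ⟨i, hi⟩ => ht i hi
    simp only [hL', dif_neg hex]
  -- At the ends of an arc the diagrams agree, and both use the same constant `κ i`; hence the
  -- pieces of `L'` fit together.
  have hLO : ∀ t ∈ Set.Ioo (0 : ℝ) 1, (∀ i, t ∉ Set.Ioo (l i) (u i)) → L' t = L t := by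
    intro t ht hto
    by_cases hex : ∃ i, t ∈ Set.Icc (l i) (u i)
    · obtain ⟨i, hi⟩ := hex
      rw [hLκ' i t hi, hLκ i t hi, hagree t (Set.Ioo_subset_Icc_self ht) hto]
    · exact hLout t fun i hi => hex ⟨i, hi⟩
  refine ⟨x₀, L, L', B, κ, ⟨hx₀, hx₀p, hx₀q⟩, hL, ?_, hLe, ?_, hLout, hLκ, hLκ'⟩
  · set O : Set ℝ := {t | ∀ i, t ∉ Set.Ioo (l i) (u i)} with hO
    have hOc : IsClosed O := by
      have : O = ⋂ i, (Set.Ioo (l i) (u i))ᶜ := by ext t; simp [hO]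
      rw [this]
      exact isClosed_iInter fun i => isOpen_Ioo.isClosed_compl
    have hcover : Set.Ioo (0 : ℝ) 1 ⊆ (O ∩ Set.Ioo 0 1) ∪ ⋃ i, Set.Icc (l i) (u i) := by
      intro t ht
      by_cases hto : t ∈ O
      · exact Or.inl ⟨hto, ht⟩
      · simp only [hO, Set.mem_ofPred_eq, not_forall, not_not] at hto
        obtain ⟨i, hi⟩ := hto
        exact Or.inr (Set.mem_iUnion.2 ⟨i, Set.Ioo_subset_Icc_self hi⟩)
    have hunion : ContinuousOn L' (⋃ i, Set.Icc (l i) (u i)) :=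
      (locallyFinite_of_finite _).continuousOn_iUnion (fun i => isClosed_Icc) fun i =>
        ((hBc.comp hγc'.continuousOn (hmemD' i)).add continuousOn_const).congr (hLκ' i)
    intro t ht
    refine ContinuousWithinAt.mono (ContinuousWithinAt.union ?_ ?_) hcover
    · by_cases hto : t ∈ O
      · exact ((hL t ht).mono Set.inter_subset_right).congr (fun x hx => hLO x hx.2 hx.1)
          (hLO t ht hto)
      · refine continuousWithinAt_of_notMem_closure fun hcl => hto ?_
        exact hOc.closure_subset (closure_mono Set.inter_subset_left hcl)
    · by_cases hto : t ∈ ⋃ i, Set.Icc (l i) (u i)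
      · exact hunion t hto
      · refine continuousWithinAt_of_notMem_closure fun hcl => hto ?_
        exact (isClosed_iUnion_of_finite fun i => isClosed_Icc).closure_subset hcl
  · intro t ht
    by_cases hex : ∃ i, t ∈ Set.Icc (l i) (u i)
    · obtain ⟨i, hi⟩ := hex
      rw [hLκ' i t hi, Complex.exp_add, hBe _ (hmemD' i t hi)]
      have h1 := hLe t ht
      rw [hLκ i t hi, Complex.exp_add, hBe _ (hmemD i t hi)] at h1
      have h2 : Complex.exp (κ i) = 1 :=
        mul_left_cancel₀ (hDR _ (hmemD i t hi)) (by rw [h1, mul_one])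
      rw [h2, mul_one]
    · have hout : ∀ i, t ∉ Set.Icc (l i) (u i) := fun i hi => hex ⟨i, hi⟩
      rw [hLout t hout, hLe t ht,
        hagree t (Set.Ioo_subset_Icc_self ht) fun i hi => hout i (Set.Ioo_subset_Icc_self hi)]

theorem AgreeOutsideDisk.endpoints_eq (h : K.AgreeOutsideDisk K' l u) :
    K.γ 0 = K'.γ 0 ∧ K.γ 1 = K'.γ 1 := by
  obtain ⟨f, -, hK, -, hagree, -⟩ := h
  refine ⟨hagree 0 (by simp) fun i hi => ?_, hagree 1 (by simp) fun i hi => ?_⟩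
  · exact absurd (hK.interval i).1 (not_lt.2 hi.1.le)
  · exact absurd (hK.interval i).2.2 (not_lt.2 hi.2.le)

/-- For two diagrams that agree outside a disk, the crossings outside the disk have the same
index, and the index of a crossing in the disk is determined by the two arcs that cross. -/
theorem AgreeOutsideDisk.exists_index (h : K.AgreeOutsideDisk K' l u) :
    ∃ κ : Fin m → ℝ,
      (∀ s t, K.IsDouble s t → K'.IsDouble s t → s < t → (∀ i, s ∉ Set.Icc (l i) (u i)) →
        (∀ i, t ∉ Set.Icc (l i) (u i)) → ∀ n, K.HasIndex (s, t) n ↔ K'.HasIndex (s, t) n) ∧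
      (∀ s t i j, K.IsDouble s t → s < t → s ∈ Set.Icc (l i) (u i) → t ∈ Set.Icc (l j) (u j) →
        ∀ n : ℤ, K.HasIndex (s, t) n ↔ κ j - κ i = 2 * Real.pi * n) ∧
      (∀ s t i j, K'.IsDouble s t → s < t → s ∈ Set.Icc (l i) (u i) → t ∈ Set.Icc (l j) (u j) →
        ∀ n : ℤ, K'.HasIndex (s, t) n ↔ κ j - κ i = 2 * Real.pi * n) := by
  obtain ⟨x₀, L, L', B, κ, ⟨hx₀, hx₀p, hx₀q⟩, hL, hL', hLe, hLe', hout, hκ, hκ'⟩ := h.exists_log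
  obtain ⟨e0, e1⟩ := h.endpoints_eq
  have hI : ∀ s t, K.IsDouble s t → s < t → ∀ n : ℤ,
      K.HasIndex (s, t) n ↔ (L t - L s).im = 2 * Real.pi * n := by
    intro s t hd hst n
    have hsub := Icc_subset_Ioo hd.mem_Ioo hd.symm.mem_Ioo
    rw [hasIndex_iff_relPos hx₀ hx₀p hx₀q]
    exact HasArgChange.iff_eq hst.le ⟨L, hL.mono hsub, fun τ hτ => hLe τ (hsub hτ), rfl⟩
  have hI' : ∀ s t, K'.IsDouble s t → s < t → ∀ n : ℤ,
      K'.HasIndex (s, t) n ↔ (L' t - L' s).im = 2 * Real.pi * n := by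
    intro s t hd hst n
    have hsub := Icc_subset_Ioo hd.mem_Ioo hd.symm.mem_Ioo
    rw [hasIndex_iff_relPos (K := K') hx₀ (by rwa [← e0]) (by rwa [← e1]), ← e0, ← e1]
    exact HasArgChange.iff_eq hst.le ⟨L', hL'.mono hsub, fun τ hτ => hLe' τ (hsub hτ), rfl⟩
  -- At a crossing in the disk both strands have the same value of `B`, so only the constants of the
  -- two arcs remain, and these are common to both diagrams.
  refine ⟨fun i => (κ i).im, ?_, ?_, ?_⟩
  · intro s t hd hd' hst hs ht n
    rw [hI s t hd hst, hI' s t hd' hst, hout s hs, hout t ht]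
  · intro s t i j hd hst hs ht n
    rw [hI s t hd hst, hκ i s hs, hκ j t ht, hd.2.2.2]
    simp
  · intro s t i j hd hst hs ht n
    rw [hI' s t hd hst, hκ' i s hs, hκ' j t ht, hd.2.2.2]
    simp

open Classical in
/-- The crossings in the disk whose intersections with the diagram are the arcs on `[l i, u i]`. -/
noncomputable def innerCrossings (K : KnotoidDiagram) (l u : Fin m → ℝ) : Finset (ℝ × ℝ) :=
  {c ∈ K.finite_double.toFinset | ∃ i, c.1 ∈ Set.Icc (l i) (u i)}

theorem MeetsDiskInArcs.mem_innerCrossings {f : EuclideanSpace ℝ (Fin 2) → E3}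
    (h : K.MeetsDiskInArcs f l u) {c : ℝ × ℝ} :
    c ∈ K.innerCrossings l u ↔ K.IsDoubleOn l u c.1 c.2 ∧ c.1 < c.2 := by
  rw [innerCrossings, Finset.mem_filter, mem_crossings_iff, h.isDoubleOn_iff]
  tauto

/-- The writhes of two diagrams that agree outside a disk are equal if the crossings in the
disk have the same contributions. -/
theorem AgreeOutsideDisk.writhe_eq (h : K.AgreeOutsideDisk K' l u) {n : ℤ}
    (hsum : ∑ c ∈ K.innerCrossings l u, K.writheTerm n c =
      ∑ c ∈ K'.innerCrossings l u, K'.writheTerm n c) : K.writhe n = K'.writhe n := by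
  classical
  obtain ⟨κ, hidx, -, -⟩ := h.exists_index
  obtain ⟨f, -, hK, hK', hagree, ho⟩ := h
  have hdouble : ∀ s t, (∀ i, s ∉ Set.Icc (l i) (u i)) → (∀ i, t ∉ Set.Icc (l i) (u i)) →
      (K.IsDouble s t ↔ K'.IsDouble s t) := by
    intro s t hs ht
    unfold IsDouble
    constructor <;> rintro ⟨h1, h2, h3, h4⟩ <;> refine ⟨h1, h2, h3, ?_⟩
    · rwa [← hagree s h1 fun i hi => hs i (Set.Ioo_subset_Icc_self hi),
        ← hagree t h2 fun i hi => ht i (Set.Ioo_subset_Icc_self hi)]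
    · rwa [hagree s h1 fun i hi => hs i (Set.Ioo_subset_Icc_self hi),
        hagree t h2 fun i hi => ht i (Set.Ioo_subset_Icc_self hi)]
  rw [KnotoidDiagram.writhe_eq, KnotoidDiagram.writhe_eq]
  congr 2
  rw [← Finset.sum_filter_add_sum_filter_not K.finite_double.toFinset
      (fun c => ∃ i, c.1 ∈ Set.Icc (l i) (u i)),
    ← Finset.sum_filter_add_sum_filter_not K'.finite_double.toFinset
      (fun c => ∃ i, c.1 ∈ Set.Icc (l i) (u i))]
  refine congrArg₂ (· + ·) ?_ ?_
  · convert hsum using 2 <;> exact Finset.filter_congr_decidable _ _ _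
  · refine Finset.sum_congr ?_ ?_
    · ext c
      rw [Finset.mem_filter, Finset.mem_filter, mem_crossings_iff, mem_crossings_iff]
      constructor
      · rintro ⟨⟨hd, hlt⟩, hc⟩
        have hc2 := hc
        rw [hK.mem_arc_iff hd] at hc2
        exact ⟨⟨(hdouble _ _ (not_exists.1 hc) (not_exists.1 hc2)).1 hd, hlt⟩, hc⟩
      · rintro ⟨⟨hd, hlt⟩, hc⟩
        have hc2 := hc
        rw [hK'.mem_arc_iff hd] at hc2
        exact ⟨⟨(hdouble _ _ (not_exists.1 hc) (not_exists.1 hc2)).2 hd, hlt⟩, hc⟩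
    · intro c hc
      rw [Finset.mem_filter, mem_crossings_iff] at hc
      obtain ⟨⟨hd', hlt⟩, hc1⟩ := hc
      have hc2 := hc1
      rw [hK'.mem_arc_iff hd'] at hc2
      have hs := not_exists.1 hc1
      have ht := not_exists.1 hc2
      have hd := (hdouble _ _ hs ht).2 hd'
      refine writheTerm_congr (hidx _ _ hd hd' hlt hs ht n) ?_
      have es := eventuallyEq_of_agree hagree hd.mem_Ioo hs
      have et := eventuallyEq_of_agree hagree hd.symm.mem_Ioo ht
      refine crossingSign_congr (ho _ _ hd hs) ?_
      rw [es.eq_of_nhds, es.deriv_eq, et.deriv_eq]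

/-! ### The Reidemeister moves -/

/-- Both strands of the curl lie on the same arc, so the new crossing has index 0 and affects no
writhe with `n ≠ 0`. -/
theorem ReidemeisterOne.writhe_eq (h : K.ReidemeisterOne K') {n : ℤ} (hn : n ≠ 0) :
    K.writhe n = K'.writhe n := by
  obtain ⟨l, u, hA, hK0, p, q, hp, hq, hpq, hK1⟩ := h
  obtain ⟨κ, -, -, hidx'⟩ := hA.exists_index
  refine hA.writhe_eq ?_
  obtain ⟨f, -, hK, hK', -, -⟩ := hA
  rw [Finset.sum_eq_zero fun c hc => absurd (hK.mem_innerCrossings.1 hc).1 (hK0 _ _),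
    Finset.sum_eq_zero fun c hc => ?_]
  obtain ⟨⟨hd, ⟨i, hi⟩, j, hj⟩, hlt⟩ := hK'.mem_innerCrossings.1 hc
  rw [writheTerm, if_neg]
  intro hidx
  rw [hidx' c.1 c.2 i j hd hlt hi hj, Subsingleton.elim j i, sub_self] at hidx
  have hpi : (2 * Real.pi) ≠ 0 := by positivity
  have := (mul_eq_zero.1 hidx.symm).resolve_left hpi
  exact hn (by exact_mod_cast this)

/-- The two new crossings involve the same two arcs in the same order, so they have the same index,
and their opposite signs cancel. -/
theorem ReidemeisterTwo.writhe_eq (h : K.ReidemeisterTwo K') (n : ℤ) :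
    K.writhe n = K'.writhe n := by
  classical
  obtain ⟨l, u, hA, hK0, p, p', q, q', hp, hp', hpp, hq, hq', hqq, hdbl, -, -, hsign⟩ := h
  obtain ⟨κ, -, -, hidx'⟩ := hA.exists_index
  refine hA.writhe_eq ?_
  obtain ⟨f, -, hK, hK', -, -⟩ := hA
  rw [Finset.sum_eq_zero fun c hc => absurd (hK.mem_innerCrossings.1 hc).1 (hK0 _ _)]
  symm
  have hd : K'.IsDouble p q := ((hdbl p q).2 (Or.inl rfl)).1
  have hd' : K'.IsDouble p' q' := ((hdbl p' q').2 (Or.inr rfl)).1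
  replace hp := Set.Ioo_subset_Icc_self hp
  replace hp' := Set.Ioo_subset_Icc_self hp'
  replace hq := Set.Ioo_subset_Icc_self hq
  replace hq' := Set.Ioo_subset_Icc_self hq'
  -- A crossing lists its earlier time first, so its form depends on which of the two arcs is
  -- traversed first.
  rcases lt_or_ge (l 0) (l 1) with hl | hl
  · have h1 : p < q := (hK'.lt_iff zero_ne_one hp hq).2 hl
    have h2 : p' < q' := (hK'.lt_iff zero_ne_one hp' hq').2 hl
    have hset : K'.innerCrossings l u = {(p, q), (p', q')} := by
      ext ⟨s, t⟩
      rw [hK'.mem_innerCrossings, hdbl, Finset.mem_insert, Finset.mem_singleton, Sym2.eq_iff,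
        Sym2.eq_iff, Prod.mk.injEq, Prod.mk.injEq]
      constructor
      · rintro ⟨(h | h) | (h | h), hlt⟩
        · exact Or.inl h
        · exact absurd hlt (by rw [h.1, h.2]; exact not_lt.2 h1.le)
        · exact Or.inr h
        · exact absurd hlt (by rw [h.1, h.2]; exact not_lt.2 h2.le)
      · rintro (h | h)
        · exact ⟨Or.inl (Or.inl h), by rw [h.1, h.2]; exact h1⟩
        · exact ⟨Or.inr (Or.inl h), by rw [h.1, h.2]; exact h2⟩
    rw [hset, Finset.sum_pair fun h => hpp (congrArg Prod.fst h)]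
    unfold writheTerm
    simp only [hidx' p q 0 1 hd h1 hp hq n, hidx' p' q' 0 1 hd' h2 hp' hq' n, hsign]
    split_ifs <;> simp
  · have h1 : q < p := lt_of_le_of_ne
      (not_lt.1 fun h => absurd ((hK'.lt_iff zero_ne_one hp hq).1 h) (not_lt.2 hl)) hd.2.2.1.symm
    have h2 : q' < p' := lt_of_le_of_ne
      (not_lt.1 fun h => absurd ((hK'.lt_iff zero_ne_one hp' hq').1 h) (not_lt.2 hl))
      hd'.2.2.1.symm
    have hset : K'.innerCrossings l u = {(q, p), (q', p')} := by
      ext ⟨s, t⟩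
      rw [hK'.mem_innerCrossings, hdbl, Finset.mem_insert, Finset.mem_singleton, Sym2.eq_iff,
        Sym2.eq_iff, Prod.mk.injEq, Prod.mk.injEq]
      constructor
      · rintro ⟨(h | h) | (h | h), hlt⟩
        · exact absurd hlt (by rw [h.1, h.2]; exact not_lt.2 h1.le)
        · exact Or.inl h
        · exact absurd hlt (by rw [h.1, h.2]; exact not_lt.2 h2.le)
        · exact Or.inr h
      · rintro (h | h)
        · exact ⟨Or.inl (Or.inr h), by rw [h.1, h.2]; exact h1⟩
        · exact ⟨Or.inr (Or.inr h), by rw [h.1, h.2]; exact h2⟩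
    rw [hset, Finset.sum_pair fun h => hqq (congrArg Prod.fst h)]
    unfold writheTerm
    simp only [hidx' q p 1 0 hd.symm h1 hq hp n, hidx' q' p' 1 0 hd'.symm h2 hq' hp' n,
      hd.crossingSign_comm, hd'.crossingSign_comm, hsign]
    split_ifs <;> simp

/-- The crossings of a triangle correspond to the pairs of arcs. -/
theorem IsTriangle.sum_innerCrossings {l u : Fin 3 → ℝ} {p : Fin 3 → Fin 3 → ℝ}
    {f : EuclideanSpace ℝ (Fin 2) → E3} (h : K.IsTriangle l u p) (hK : K.MeetsDiskInArcs f l u)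
    (F : ℝ × ℝ → ℤ) : ∑ c ∈ K.innerCrossings l u, F c =
      ∑ x : Fin 3 × Fin 3 with x.1 ≠ x.2 ∧ l x.1 < l x.2, F (p x.1 x.2, p x.2 x.1) := by
  have hmem : ∀ i j, i ≠ j → p i j ∈ Set.Icc (l i) (u i) := fun i j hij =>
    Set.Ioo_subset_Icc_self (h.mem i j hij)
  symm
  refine Finset.sum_nbij (fun x => (p x.1 x.2, p x.2 x.1)) ?_ ?_ ?_ fun _ _ => rfl
  · intro x hx
    obtain ⟨-, hne, hlt⟩ := Finset.mem_filter.1 hx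
    rw [hK.mem_innerCrossings]
    exact ⟨(h.double _ _).2 ⟨x.1, x.2, hne, rfl, rfl⟩,
      (hK.lt_iff hne (hmem _ _ hne) (hmem _ _ hne.symm)).2 hlt⟩
  · intro x hx y hy hxy
    obtain ⟨-, hx, -⟩ := Finset.mem_filter.1 hx
    obtain ⟨-, hy, -⟩ := Finset.mem_filter.1 hy
    obtain ⟨h1, h2⟩ := Prod.mk.injEq .. ▸ hxy
    have m1 := hmem _ _ hx
    have m2 := hmem _ _ hx.symm
    rw [h1] at m1
    rw [h2] at m2
    exact Prod.ext (hK.eq_of_mem m1 (hmem _ _ hy)) (hK.eq_of_mem m2 (hmem _ _ hy.symm))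
  · rintro ⟨s, t⟩ hc
    rw [Finset.mem_coe, hK.mem_innerCrossings] at hc
    obtain ⟨hd, hlt⟩ := hc
    obtain ⟨i, j, hij, rfl, rfl⟩ := (h.double _ _).1 hd
    refine ⟨(i, j), ?_, rfl⟩
    rw [Finset.mem_coe, Finset.mem_filter]
    exact ⟨Finset.mem_univ _, hij, (hK.lt_iff hij (hmem _ _ hij) (hmem _ _ hij.symm)).1 hlt⟩

/-- Corresponding crossings involve the same pair of arcs, hence have the same index before and
after the move, and their signs agree. -/
theorem ReidemeisterThree.writhe_eq (h : K.ReidemeisterThree K') (n : ℤ) :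
    K.writhe n = K'.writhe n := by
  obtain ⟨l, u, hA, p, p', hT, hT', -, hsign⟩ := h
  obtain ⟨κ, -, hidx, hidx'⟩ := hA.exists_index
  refine hA.writhe_eq ?_
  obtain ⟨f, -, hK, hK', -, -⟩ := hA
  rw [hT.sum_innerCrossings hK, hT'.sum_innerCrossings hK']
  refine Finset.sum_congr rfl fun x hx => ?_
  obtain ⟨-, hne, hlt⟩ := Finset.mem_filter.1 hx
  have m := fun i j hij => Set.Ioo_subset_Icc_self (hT.mem i j hij)
  have m' := fun i j hij => Set.Ioo_subset_Icc_self (hT'.mem i j hij)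
  refine writheTerm_congr ?_ (hsign _ _ hne)
  rw [hidx _ _ x.1 x.2 ((hT.double _ _).2 ⟨x.1, x.2, hne, rfl, rfl⟩).1
      ((hK.lt_iff hne (m _ _ hne) (m _ _ hne.symm)).2 hlt) (m _ _ hne) (m _ _ hne.symm),
    hidx' _ _ x.1 x.2 ((hT'.double _ _).2 ⟨x.1, x.2, hne, rfl, rfl⟩).1
      ((hK'.lt_iff hne (m' _ _ hne) (m' _ _ hne.symm)).2 hlt) (m' _ _ hne) (m' _ _ hne.symm)]

/-! ### The index polynomial of a knotoid -/

theorem Move.writhe_eq (h : Move K K') {n : ℤ} (hn : n ≠ 0) : K.writhe n = K'.writhe n := by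
  cases h with
  | planarIsotopy h => exact h.writhe_eq n
  | reparametrization h => exact h.writhe_eq n
  | reidemeisterOne h => exact h.writhe_eq hn
  | reidemeisterTwo h => exact h.writhe_eq n
  | reidemeisterThree h => exact h.writhe_eq n

/-- The index polynomial is an invariant of knotoids. -/
theorem Represents.indexPolynomial_eq {k : Knotoid} (h : K.Represents k) (h' : K'.Represents k) :
    K.indexPolynomial = K'.indexPolynomial := by
  have hrel : Relation.EqvGen Move K K' := Quotient.exact (h.trans h'.symm)
  refine indexPolynomial_congr fun n hn => ?_
  clear h h'
  induction hrel with
  | rel _ _ h => exact h.writhe_eq hn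
  | refl _ => rfl
  | symm _ _ _ ih => exact ih.symm
  | trans _ _ _ _ _ ih₁ ih₂ => exact ih₁.trans ih₂

end KnotoidDiagram

theorem theorem1p7 (k : Knotoid) (D : KnotoidDiagram) (hD : D.Represents k)
    (A : List ℤˣ) (hA : k.Attainable A) :
    (∃ B : List ℤˣ, B <:+: A ∧ signSum B = degPlus D.indexPolynomial) ∧
    (∃ B : List ℤˣ, B <:+: A ∧ signSum B = - degMinus D.indexPolynomial) := by
  obtain ⟨K, S, hK, rfl⟩ := hA
  rw [hD.indexPolynomial_eq hK]
  exact ⟨S.exists_block_degPlus, S.exists_block_degMinus⟩
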